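/- Let $\mathcal K$ be a metric abstract elementary class (a class of complete metric structures with a strong-substructure relation $\prec$, closed under isomorphism, where $\prec$ is a partial order refining inclusion, satisfying closure under completions of unions of $\prec$-increasing chains, coherence, and the downward Löwenheim–Skolem axiom with number $LS^d(\mathcal K)$). Write $dc$ for density character. Let $\mathbb M\in\mathcal K$ be a monster model: every isomorphism between two strong substructures of $\mathbb M$ of density character $<dc(\mathbb M)$ extends to an automorphism of $\mathbb M$, and every member of $\mathcal K$ of density character $<dc(\mathbb M)$ $\mathcal K$-embeds into $\mathbb M$. "Model" below means strong substructure of $\mathbb M$. Galois types $\mathrm{tp}(a/M)$ are orbits of elements $a\in\mathbb M$ under $\mathrm{Aut}(\mathbb M/M)$, with $d(p,q)=\inf\{d(a,b):a\models p,\ b\models q\}$. Assume the continuity of types property: if $dc(M)<dc(\mathbb M)$, $a_n\to a$ and $\mathrm{tp}(a_n/M)=\mathrm{tp}(a_0/M)$ for all $n$, then $\mathrm{tp}(a/M)=\mathrm{tp}(a_0/M)$. Let $\mu$ be a cardinal with $LS^d(\mathcal K)\le\mu<dc(\mathbb M)$, and let $I$ be a well-ordering with $|I|=\mu$ and $\mathrm{cf}(I)>\omega$.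 Definitions. For $N\prec M$, $M$ is $\lambda$-universal over $N$ if every $N'\in\mathcal K$ with $N'\succ N$ and $dc(N')=\lambda$ admits a $\mathcal K$-embedding into $M$ fixing $N$ pointwise; $M$ is universal over $N$ if it is $dc(M)$-universal over $N$. A resolution of $M$ is an increasing continuous $\prec$-chain $(M^\gamma)_{\gamma<\sigma}$ of models of density character $\mu$ with $M=\overline{\bigcup_{\gamma<\sigma}M^\gamma}$ (continuous: $M^\gamma=\overline{\bigcup_{\beta<\gamma}M^\beta}$ for limit $\gamma<\sigma$). It witnesses that $M$ is a $(\mu,\sigma)$-limit over $N$ if $\sigma$ is a limit ordinal, $M^0=N$, and each $M^{\gamma+1}$ is $\mu$-universal over $M^\gamma$. It is spread-out if each $M^{\gamma+1}$ is a $(\mu,\omega_1)$-limit over $M^\gamma$. The type $\mathrm{tp}(a/M)$ $\varepsilon$-splits over $N\prec M$ if there are models $N_1,N_2$ with $N\prec N_1,N_2\prec M$ and an isomorphism $h:N_1\cong N_2$ fixing $N$ pointwise such that $d\big(\mathrm{tp}(a/N_2),h(\mathrm{tp}(a/N_1))\big)\ge\varepsilon$. For a resolution $\mathcal N=(N^\gamma)_{\gamma<\sigma}$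 of $N\prec M$, $a$ is smoothly independent from $M$ over $N$ relative to $\mathcal N$ if for every $\varepsilon>0$ there is $\gamma<\sigma$ such that $\mathrm{tp}(a/M)$ does not $\varepsilon$-split over $N^\gamma$. Let $\mathcal K^*_{\mu,I}$ be the class of metric s-towers indexed by $I$: the tuples $(M_i,a_i,N_i,\mathcal M_i,\mathcal N_i)_{i\in I}$ such that $(M_i)_{i\in I}$ is a $\prec$-increasing chain, all models $M_i,N_i$ have density character $\mu$, $\mathcal M_i$ and $\mathcal N_i$ are resolutions of $M_i$ and $N_i$, $\mathcal M_i$ has length $<\mu^+$, is spread-out and witnesses that $M_i$ is a limit model over $N_i$, $a_i\in M_{i+1}\setminus M_i$, and $a_i$ is smoothly independent from $M_i$ over $N_i$ relative to $\mathcal N_i$. For two such towers put $(M_i',a_i',N_i',\mathcal M_i',\mathcal N_i')_{i\in I}>(M_i,a_i,N_i,\mathcal M_i,\mathcal N_i)_{i\in I}$ if for every $i\in I$: $M_i'$ is a proper universal extension of $M_i$, $\mathcal M_i$ is an initial segment of $\mathcal M_i'$, $a_i'=a_i$, $N_i'=N_i$ and $\mathcal N_i'=\mathcal N_i$. Proposition.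 For every tower $(M_i,a_i,N_i,\mathcal M_i,\mathcal N_i)_{i\in I}\in\mathcal K^*_{\mu,I}$ there is a tower $(M_i',a_i,N_i,\mathcal M_i',\mathcal N_i)_{i\in I}>(M_i,a_i,N_i,\mathcal M_i,\mathcal N_i)_{i\in I}$ in $\mathcal K^*_{\mu,I}$ such that for every limit element $i\in I$, $M_i'$ is a $(\mu,\mu)$-limit over $\overline{\bigcup_{j<i}M_j}$. -/

import Mathlib

open Set Cardinal

universe u v w

namespace MetricAEC

/-- Density character of a subset `A` of a topological space: the least cardinality of a dense
subset of the closure of `A`. -/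
noncomputable def densChar {X : Type u} [TopologicalSpace X] (A : Set X) : Cardinal.{u} :=
  sInf {c : Cardinal.{u} | ∃ D : Set X, D ⊆ closure A ∧ closure A ⊆ closure D ∧ #D = c}

/-- A metric structure for the language `L`: a complete metric space in which the function symbols
(constants are the `0`-ary ones) are interpreted by continuous functions and the relation symbols
by closed sets. No uniform continuity is asked for. -/
structure MetricStr (L : FirstOrder.Language.{v, w}) where
  carrier : Type u
  [metric : MetricSpace carrier]
  [complete : CompleteSpace carrier]
  [str : L.Structure carrier]
  continuous_fun : ∀ {n : ℕ} (F : L.Functions n),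
    Continuous (fun x : Fin n → carrier => FirstOrder.Language.Structure.funMap F x)
  isClosed_rel : ∀ {n : ℕ} (R : L.Relations n),
    IsClosed {x : Fin n → carrier | FirstOrder.Language.Structure.RelMap R x}

attribute [instance] MetricStr.metric MetricStr.complete MetricStr.str

variable {L : FirstOrder.Language.{v, w}}

/-- The interpretation of a function symbol. -/
def MetricStr.fn (M : MetricStr.{u} L) {n : ℕ} (F : L.Functions n) (x : Fin n → M.carrier) :
    M.carrier :=
  FirstOrder.Language.Structure.funMap F x

/-- The interpretation of a relation symbol, as a set of tuples. -/
def MetricStr.rel (M : MetricStr.{u} L) {n : ℕ} (R : L.Relations n) : Set (Fin n → M.carrier) :=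
  {x | FirstOrder.Language.Structure.RelMap R x}

/-- The density character of a metric structure. -/
noncomputable def MetricStr.dc (M : MetricStr.{u} L) : Cardinal.{u} :=
  densChar (Set.univ : Set M.carrier)

/-- A (complete) metric substructure of `N`. Tuples carry the maximum metric, and the distance to
an interpreted relation is the same computed inside and outside the substructure. -/
@[ext] structure SubStr (N : MetricStr.{u} L) where
  carrier : Set N.carrier
  isClosed : IsClosed carrier
  fn_mem : ∀ {n : ℕ} (F : L.Functions n) (x : Fin n → N.carrier),
    (∀ k, x k ∈ carrier) → N.fn F x ∈ carrier
  rel_dist : ∀ {n : ℕ} (R : L.Relations n) (x : Fin n → N.carrier), (∀ k, x k ∈ carrier) →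
    Metric.infEDist x {y | y ∈ N.rel R ∧ ∀ k, y k ∈ carrier} = Metric.infEDist x (N.rel R)

/-- A substructure, regarded as a metric structure of its own. -/
def SubStr.toStr {N : MetricStr.{u} L} (S : SubStr N) : MetricStr.{u} L where
  carrier := S.carrier
  metric := inferInstance
  complete := S.isClosed.completeSpace_coe
  str :=
    { funMap := fun F x => ⟨N.fn F (fun k => (x k).1), S.fn_mem F _ fun k => (x k).2⟩
      RelMap := fun R x => (fun k => (x k).1) ∈ N.rel R }
  continuous_fun := fun F =>
    ((N.continuous_fun F).comp
      (continuous_pi fun k => continuous_subtype_val.comp (continuous_apply k))).subtype_mk _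
  isClosed_rel := fun R =>
    (N.isClosed_rel R).preimage
      (continuous_pi fun k => continuous_subtype_val.comp (continuous_apply k))

/-- If `T ⊆ S` are substructures of `N`, then `T` is a substructure of `S`. -/
def SubStr.restrict {N : MetricStr.{u} L} (T S : SubStr N) (h : T.carrier ⊆ S.carrier) :
    SubStr S.toStr where
  carrier := {x : S.carrier | x.1 ∈ T.carrier}
  isClosed := T.isClosed.preimage continuous_subtype_val
  fn_mem := fun F x hx => T.fn_mem F (fun k => (x k).1) hx
  rel_dist := fun {n} R x hx => by
    let v : (Fin n → S.toStr.carrier) → (Fin n → N.carrier) := fun y k => (y k).1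
    have hv : Isometry v := fun a b => by
      rw [edist_pi_def, edist_pi_def]
      rfl
    have e1 : v '' {y | y ∈ S.toStr.rel R ∧ ∀ k, (y k).1 ∈ T.carrier} =
        {y | y ∈ N.rel R ∧ ∀ k, y k ∈ T.carrier} := by
      ext y
      constructor
      · rintro ⟨z, ⟨h1, h2⟩, rfl⟩
        exact ⟨h1, h2⟩
      · rintro ⟨h1, h2⟩
        exact ⟨fun k => ⟨y k, h (h2 k)⟩, ⟨h1, h2⟩, rfl⟩
    have e2 : v '' (S.toStr.rel R) = {y | y ∈ N.rel R ∧ ∀ k, y k ∈ S.carrier} := by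
      ext y
      constructor
      · rintro ⟨z, h1, rfl⟩
        exact ⟨h1, fun k => (z k).2⟩
      · rintro ⟨h1, h2⟩
        exact ⟨fun k => ⟨y k, h2 k⟩, h1, rfl⟩
    have a1 := Metric.infEDist_image (x := x)
      (t := {y | y ∈ S.toStr.rel R ∧ ∀ k, (y k).1 ∈ T.carrier}) hv
    have a2 := Metric.infEDist_image (x := x) (t := S.toStr.rel R) hv
    rw [e1] at a1
    rw [e2] at a2
    exact a1.symm.trans (((T.rel_dist R (v x) hx).trans
      (S.rel_dist R (v x) fun k => (x k).2).symm).trans a2)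

/-- Isomorphisms of metric structures. -/
structure StrIso (M N : MetricStr.{u} L) extends M.carrier ≃ᵢ N.carrier where
  map_fn : ∀ {n : ℕ} (F : L.Functions n) (x : Fin n → M.carrier),
    toFun (M.fn F x) = N.fn F (fun k => toFun (x k))
  map_rel : ∀ {n : ℕ} (R : L.Relations n) (x : Fin n → M.carrier),
    x ∈ M.rel R ↔ (fun k => toFun (x k)) ∈ N.rel R

instance (M N : MetricStr.{u} L) : CoeFun (StrIso M N) (fun _ => M.carrier → N.carrier) :=
  ⟨fun e => e.toFun⟩

/-- A class of metric structures with a relation "`S` is a strong substructure of `N`",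
written `S ≺ N` in the literature. -/
structure StrClass (L : FirstOrder.Language.{v, w}) where
  Mem : MetricStr.{u} L → Prop
  Strong : ∀ {N : MetricStr.{u} L}, SubStr N → Prop

/-- `f : M → N` is a `K`-embedding: it is isometric, commutes with the function symbols (hence also
with the constants), preserves the distance to every relation, and its image is strong in `N`. -/
structure StrClass.IsEmb (K : StrClass.{u} L) {M N : MetricStr.{u} L}
    (f : M.carrier → N.carrier) : Prop where
  isometry : Isometry f
  map_fn : ∀ {n : ℕ} (F : L.Functions n) (x : Fin n → M.carrier),
    f (M.fn F x) = N.fn F (fun k => f (x k))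
  map_rel : ∀ {n : ℕ} (R : L.Relations n) (x : Fin n → M.carrier),
    Metric.infEDist x (M.rel R) = Metric.infEDist (fun k => f (x k)) (N.rel R)
  strong_range : ∃ S : SubStr N, S.carrier = Set.range f ∧ K.Strong S

/-- Metric abstract elementary classes. -/
structure MAEC (L : FirstOrder.Language.{v, w}) extends StrClass.{u} L where
  /-- `≺` relates members of the class. -/
  mem_of_strong : ∀ {N : MetricStr.{u} L} (S : SubStr N), Strong S → Mem N ∧ Mem S.toStr
  /-- The class is closed under isomorphism. -/
  mem_iso : ∀ {M N : MetricStr.{u} L}, StrIso M N → Mem M → Mem N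
  /-- The relation `≺` is closed under isomorphism. -/
  strong_iso : ∀ {M N : MetricStr.{u} L} (e : StrIso M N) (S : SubStr M) (S' : SubStr N),
    S'.carrier = e '' S.carrier → Strong S → Strong S'
  /-- `≺` is reflexive. -/
  strong_refl : ∀ {N : MetricStr.{u} L} (S : SubStr N), Mem N → S.carrier = Set.univ → Strong S
  /-- `≺` is transitive. -/
  strong_trans : ∀ {N : MetricStr.{u} L} (T S : SubStr N) (h : T.carrier ⊆ S.carrier),
    Strong (T.restrict S h) → Strong S → Strong T
  /-- Coherence. -/
  coherence : ∀ {N : MetricStr.{u} L} (T S : SubStr N) (h : T.carrier ⊆ S.carrier),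
    Strong S → Strong T → Strong (T.restrict S h)
  /-- Completions of unions of increasing chains: the completion of the union carries a structure
  in the class of which all members of the chain are strong substructures. A chain is given up to
  isomorphism, by a system of `K`-embeddings indexed by a well-order. (The structure on the
  completion is unique: functions are continuous and relations are closed.) -/
  chain_completion : ∀ {ι : Type u} [LinearOrder ι] [WellFoundedLT ι] [Nonempty ι]
    (M : ι → MetricStr.{u} L) (f : ∀ i j, i ≤ j → (M i).carrier → (M j).carrier),
    (∀ i j h, toStrClass.IsEmb (f i j h)) → (∀ i x, f i i le_rfl x = x) →
    (∀ i j k (hij : i ≤ j) (hjk : j ≤ k) x,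
      f j k hjk (f i j hij x) = f i k (hij.trans hjk) x) →
    ∃ (N : MetricStr.{u} L) (g : ∀ i, (M i).carrier → N.carrier), Mem N ∧
      (∀ i, toStrClass.IsEmb (g i)) ∧ (∀ i j h x, g j (f i j h x) = g i x) ∧
      closure (⋃ i, Set.range (g i)) = Set.univ
  /-- If all members of a chain are strong in `N`, so is the completion of their union. -/
  chain_strong : ∀ {ι : Type u} [LinearOrder ι] [WellFoundedLT ι] [Nonempty ι]
    {N : MetricStr.{u} L} (S : ι → SubStr N), (∀ i, Strong (S i)) →
    (∀ i j, i ≤ j → (S i).carrier ⊆ (S j).carrier) →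
    ∃ U : SubStr N, U.carrier = closure (⋃ i, (S i).carrier) ∧ Strong U
  /-- The metric Löwenheim–Skolem number. -/
  LS : Cardinal.{u}
  /-- Downward Löwenheim–Skolem. -/
  downward : ∀ {M : MetricStr.{u} L} (A : Set M.carrier), Mem M →
    ∃ S : SubStr M, Strong S ∧ A ⊆ S.carrier ∧ densChar S.carrier ≤ densChar A + LS

variable (K : MAEC.{u} L) (𝕄 : MetricStr.{u} L)

/-- The models inside `𝕄`: the strong substructures of `𝕄`. -/
@[ext] structure Model where
  toSub : SubStr 𝕄
  strong : K.Strong toSub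

variable {K 𝕄}

/-- The underlying set of a model. -/
def Model.set (A : Model K 𝕄) : Set 𝕄.carrier := A.toSub.carrier

/-- A model as a metric structure. -/
def Model.toStr (A : Model K 𝕄) : MetricStr.{u} L := A.toSub.toStr

/-- Density character of a model. -/
noncomputable def Model.dc (A : Model K 𝕄) : Cardinal.{u} := densChar A.set

/-- `A ≤ B` is inclusion. By `Model.le_iff_strong` this is `A ≺ B`. -/
instance : LE (Model K 𝕄) := ⟨fun A B => A.set ⊆ B.set⟩

theorem Model.le_iff_strong (A B : Model K 𝕄) :
    A ≤ B ↔ ∃ h : A.toSub.carrier ⊆ B.toSub.carrier, K.Strong (A.toSub.restrict B.toSub h) :=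
  ⟨fun h => ⟨h, K.coherence _ _ h B.strong A.strong⟩, fun h => h.1⟩

variable (K 𝕄)

/-- `𝕄` is a monster model of `K`: it is homogeneous and universal with respect to models of
density character less than that of `𝕄`. -/
structure IsMonster : Prop where
  mem : K.Mem 𝕄
  homogeneous : ∀ (A B : Model K 𝕄), A.dc < 𝕄.dc → ∀ h : StrIso A.toStr B.toStr,
    ∃ g : StrIso 𝕄 𝕄, ∀ x : A.toStr.carrier, g x.1 = (h x).1
  universal : ∀ N : MetricStr.{u} L, K.Mem N → N.dc < 𝕄.dc →
    ∃ f : N.carrier → 𝕄.carrier, K.IsEmb f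

variable {K 𝕄}

/-- The Galois type of `a` over `A`: the orbit of `a` under the automorphisms of `𝕄` that fix `A`
pointwise. -/
def gatp (a : 𝕄.carrier) (A : Model K 𝕄) : Set 𝕄.carrier :=
  {b | ∃ g : StrIso 𝕄 𝕄, (∀ x ∈ A.set, g x = x) ∧ g a = b}

/-- Distance between Galois types. -/
noncomputable def typeDist (p q : Set 𝕄.carrier) : ℝ :=
  sInf {r | ∃ a ∈ p, ∃ b ∈ q, r = dist a b}

variable (K 𝕄)

/-- Continuity of types, over models smaller than `𝕄`. -/
def ContinuityOfTypes : Prop :=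
  ∀ (A : Model K 𝕄), A.dc < 𝕄.dc → ∀ (a : ℕ → 𝕄.carrier) (b : 𝕄.carrier),
    Filter.Tendsto a Filter.atTop (nhds b) →
    (∀ n, gatp (a n) A = gatp (a 0) A) → gatp b A = gatp (a 0) A

variable {K 𝕄}

/-- `B` is `μ`-universal over `A`: `A ≺ B`, and every extension `N'` of `A` in the class of density
character `μ` (given by a `K`-embedding `e : A → N'`) embeds into `B` over `A`. -/
def IsUniversalOver (μ : Cardinal.{u}) (A B : Model K 𝕄) : Prop :=
  A ≤ B ∧ ∀ (N' : MetricStr.{u} L) (e : A.toStr.carrier → N'.carrier), K.Mem N' →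
    K.IsEmb e → N'.dc = μ →
    ∃ f : N'.carrier → B.toStr.carrier, K.IsEmb f ∧
      ∀ x : A.toStr.carrier, (f (e x)).1 = x.1

variable (K 𝕄)

/-- A sequence of models indexed by the ordinals below `length`. -/
structure ModelSeq where
  length : Ordinal.{u}
  seq : Set.Iio length → Model K 𝕄

variable {K 𝕄}

/-- `r` is a resolution of `A` (by models of density character `μ`): an increasing continuous chain
such that `A` is the completion of its union. -/
structure ModelSeq.IsResolution (μ : Cardinal.{u}) (r : ModelSeq K 𝕄) (A : Model K 𝕄) :
    Prop where
  mono : ∀ β γ, β ≤ γ → r.seq β ≤ r.seq γ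
  cont : ∀ γ : Set.Iio r.length, Order.IsSuccLimit γ.1 →
    (r.seq γ).set = closure (⋃ β : {β // β < γ}, (r.seq β.1).set)
  union : A.set = closure (⋃ γ, (r.seq γ).set)
  dc_eq : ∀ γ, (r.seq γ).dc = μ

/-- The resolution `r` of `B` witnesses that `B` is a `(μ, r.length)`-limit model over `A`. -/
structure ModelSeq.WitnessesLimit (μ : Cardinal.{u}) (r : ModelSeq K 𝕄) (A B : Model K 𝕄) :
    Prop where
  resolution : r.IsResolution μ B
  isLimit : Order.IsSuccLimit r.length
  zero : ∀ γ : Set.Iio r.length, γ.1 = 0 → r.seq γ = A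
  succ : ∀ γ δ : Set.Iio r.length, δ.1 = γ.1 + 1 → IsUniversalOver μ (r.seq γ) (r.seq δ)

/-- `B` is a `(μ, θ)`-limit model over `A`. -/
def IsLimitModel (μ : Cardinal.{u}) (θ : Ordinal.{u}) (A B : Model K 𝕄) : Prop :=
  ∃ r : ModelSeq K 𝕄, r.length = θ ∧ r.WitnessesLimit μ A B

/-- A resolution is spread-out if each successor term is a `(μ, ω₁)`-limit over the preceding
term. -/
def ModelSeq.SpreadOut (μ : Cardinal.{u}) (r : ModelSeq K 𝕄) : Prop :=
  ∀ γ δ : Set.Iio r.length, δ.1 = γ.1 + 1 →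
    IsLimitModel μ (Cardinal.aleph 1).ord (r.seq γ) (r.seq δ)

/-- The sequence `s` extends the sequence `r`. -/
def ModelSeq.IsExtendedBy (r s : ModelSeq K 𝕄) : Prop :=
  r.length ≤ s.length ∧
    ∀ (γ : Set.Iio r.length) (δ : Set.Iio s.length), δ.1 = γ.1 → s.seq δ = r.seq γ

/-- The Galois type of `a` over `M` `ε`-splits over `A`. An isomorphism `h : N₁ ≅ N₂` over `A` is
given by an automorphism `g` of `𝕄` extending it, and `h (gatp a N₁) = gatp (g a) N₂`. -/
def Splits (ε : ℝ) (a : 𝕄.carrier) (A M : Model K 𝕄) : Prop :=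
  ∃ N₁ N₂ : Model K 𝕄, A ≤ N₁ ∧ N₁ ≤ M ∧ A ≤ N₂ ∧ N₂ ≤ M ∧
    ∃ g : StrIso 𝕄 𝕄, (∀ x ∈ A.set, g x = x) ∧ g '' N₁.set = N₂.set ∧
      ε ≤ typeDist (gatp a N₂) (gatp (g a) N₂)

/-- `a` is smoothly independent from `M`, relative to the resolution `r` of a submodel. -/
def SmoothIndep (r : ModelSeq K 𝕄) (a : 𝕄.carrier) (M : Model K 𝕄) : Prop :=
  ∀ ε : ℝ, 0 < ε → ∃ γ : Set.Iio r.length, ¬ Splits ε a (r.seq γ) M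

variable (K 𝕄)

/-- The data of a tower indexed by `I`. -/
structure Tower (I : Type u) where
  M : I → Model K 𝕄
  a : I → 𝕄.carrier
  N : I → Model K 𝕄
  resM : I → ModelSeq K 𝕄
  resN : I → ModelSeq K 𝕄

variable {K 𝕄}

/-- Smooth towers. -/
structure Tower.IsSTower (μ : Cardinal.{u}) {I : Type u} [LinearOrder I] (T : Tower K 𝕄 I) :
    Prop where
  mono : ∀ i j, i ≤ j → T.M i ≤ T.M j
  dcM : ∀ i, (T.M i).dc = μ
  dcN : ∀ i, (T.N i).dc = μ
  resM : ∀ i, (T.resM i).IsResolution μ (T.M i)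
  resN : ∀ i, (T.resN i).IsResolution μ (T.N i)
  limit : ∀ i, ∃ σ < (Order.succ μ).ord, IsLimitModel μ σ (T.N i) (T.M i)
  /-- `j` is the successor of `i` in `I`. -/
  elem : ∀ i j, i ⋖ j → T.a i ∈ (T.M j).set ∧ T.a i ∉ (T.M i).set
  indep : ∀ i, SmoothIndep (T.resN i) (T.a i) (T.M i)

/-- Metric smooth towers: the resolution of `M i` belonging to the tower witnesses that `M i` is a
limit model over `N i`, and is spread-out. -/
structure Tower.IsMetricSTower (μ : Cardinal.{u}) {I : Type u} [LinearOrder I]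
    (T : Tower K 𝕄 I) : Prop extends T.IsSTower μ where
  length_lt : ∀ i, (T.resM i).length < (Order.succ μ).ord
  witness : ∀ i, (T.resM i).WitnessesLimit μ (T.N i) (T.M i)
  spreadOut : ∀ i, (T.resM i).SpreadOut μ

/-- `T'` is a (strictly) larger tower than `T`, with the same index set: each `T'.M i` is a proper
universal extension of `T.M i`, the resolution of `T'.M i` extends that of `T.M i`, and the other
entries agree. -/
structure Tower.IsExtendedBy {I : Type u} (T T' : Tower K 𝕄 I) : Prop where
  universal : ∀ i, IsUniversalOver (T'.M i).dc (T.M i) (T'.M i)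
  proper : ∀ i, T.M i ≠ T'.M i
  resM : ∀ i, (T.resM i).IsExtendedBy (T'.resM i)
  a : ∀ i, T'.a i = T.a i
  N : ∀ i, T'.N i = T.N i
  resN : ∀ i, T'.resN i = T.resN i

end MetricAEC

/-! The enlarged models must increase with the index, while enlarging one model and keeping `a i`
independent from it is possible only up to an automorphism. So a directed system is built by
recursion and straightened at the end. Write i+1 for the successor of i, which exists because `cf(I)
> ω` excludes a last element. Stage i consists of a model M*_i whose resolution prolongs that of
M_i, with a_i independent from M*_i and outside it; a model Q_i containing M*_i and M_{i+1}; and,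
for j < i, coherent automorphisms f_{ji} that fix M_{j+1} pointwise and carry Q_j into M*_i.

To build stage i, the earlier stages are mapped into one part of the monster model by their direct
limit (`Setting.exists_direct_limit`). The resolution of M_i is prolonged by μ steps, each a (μ,
ω₁)-limit, so as to absorb these images (`Setting.exists_prolongation`). An automorphism over M_i
then restores independence (`SmoothIndep.exists_extension`). That automorphism exists for the
following reason. M_i is universal over N_i, so an automorphism f over N_i maps the larger model M'
into M_i, and f⁻¹(a) is independent from M'. Non-splitting, applied to M_i and f(M_i), puts the
types of a and f⁻¹(a) over M_i at distance 0. By continuity of types they are equal, and an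
automorphism over M_i takes f⁻¹(a) to a.

The limit of the whole system gives automorphisms g_i that fix M_{i+1}, hence also a_i, and M'_i =
g_i(M*_i) is the required tower. Towers need not be continuous, so limit elements are treated like
all others. Every M'_i is a (μ, μ)-limit over M_i, and the base may be lowered to the completed
union of the M_j by changing the first term of the witnessing chain (`IsLimitModel.of_le`). -/

namespace MetricAEC

variable {L : FirstOrder.Language.{v, w}}

/-! ### Density character -/

section densChar

variable {X Y : Type u}

theorem densChar_le_of_dense [TopologicalSpace X] {A D : Set X} {κ : Cardinal.{u}}
    (h1 : D ⊆ closure A) (h2 : A ⊆ closure D) (h3 : #D ≤ κ) : densChar A ≤ κ := by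
  refine le_trans (csInf_le' ?_) h3
  exact ⟨D, h1, closure_minimal h2 isClosed_closure, rfl⟩

theorem exists_dense_mk_eq_densChar [TopologicalSpace X] (A : Set X) :
    ∃ D : Set X, D ⊆ closure A ∧ closure A ⊆ closure D ∧ #D = densChar A :=
  csInf_mem (s := {c : Cardinal.{u} | ∃ D : Set X, D ⊆ closure A ∧ closure A ⊆ closure D ∧ #D = c})
    ⟨#A, A, subset_closure, le_rfl, rfl⟩

theorem densChar_closure [TopologicalSpace X] (A : Set X) :
    densChar (closure A) = densChar A := by
  simp only [densChar, closure_closure]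

theorem densChar_iUnion_le [TopologicalSpace X] {ι : Type u} {A : ι → Set X} {κ : Cardinal.{u}}
    (hκ : ℵ₀ ≤ κ) (hι : #ι ≤ κ) (hA : ∀ i, densChar (A i) ≤ κ) : densChar (⋃ i, A i) ≤ κ := by
  choose D h1 h2 h3 using fun i => exists_dense_mk_eq_densChar (A i)
  refine densChar_le_of_dense (D := ⋃ i, D i)
    (iUnion_subset fun i => (h1 i).trans (closure_mono (subset_iUnion A i)))
    (iUnion_subset fun i => subset_closure.trans ((h2 i).trans (closure_mono (subset_iUnion D i))))
    ?_
  refine (mk_iUnion_le_sum_mk).trans ((sum_le_sum _ (fun _ => κ) fun i => ?_).trans ?_)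
  · rw [h3]; exact hA i
  · rw [sum_const']
    exact (mul_le_mul' hι le_rfl).trans (mul_eq_self hκ).le

theorem densChar_union_le [TopologicalSpace X] {A B : Set X} {κ : Cardinal.{u}} (hκ : ℵ₀ ≤ κ)
    (hA : densChar A ≤ κ) (hB : densChar B ≤ κ) : densChar (A ∪ B) ≤ κ := by
  obtain ⟨D, h1, h2, h3⟩ := exists_dense_mk_eq_densChar A
  obtain ⟨E, h4, h5, h6⟩ := exists_dense_mk_eq_densChar B
  refine densChar_le_of_dense (D := D ∪ E)
    (union_subset (h1.trans (closure_mono subset_union_left))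
      (h4.trans (closure_mono subset_union_right)))
    (union_subset (subset_closure.trans (h2.trans (closure_mono subset_union_left)))
      (subset_closure.trans (h5.trans (closure_mono subset_union_right))))
    ((mk_union_le D E).trans ?_)
  rw [h3, h6]
  exact (add_le_add hA hB).trans (add_eq_self hκ).le

/-- The density character is hereditary in metric spaces. -/
theorem densChar_mono_of_le [PseudoMetricSpace X] {A B : Set X} {κ : Cardinal.{u}} (hκ : ℵ₀ ≤ κ)
    (h : A ⊆ closure B) (hB : densChar B ≤ κ) : densChar A ≤ κ := by
  classical
  obtain ⟨D, -, h2, h3⟩ := exists_dense_mk_eq_densChar B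
  rcases A.eq_empty_or_nonempty with rfl | ⟨a₀, ha₀⟩
  · exact densChar_le_of_dense (D := ∅) (by simp) (by simp) (by simp)
  -- For each point of `D` and each radius 1/(n+1), a point of `A` that close is chosen if there is
  -- one; `a₀` is a default value.
  have key : ∀ p : D × ℕ, ∃ a ∈ A, (∃ b ∈ A, dist b p.1.1 < 1 / ((p.2 : ℝ) + 1)) →
      dist a p.1.1 < 1 / ((p.2 : ℝ) + 1) := fun p => by
    by_cases hp : ∃ b ∈ A, dist b p.1.1 < 1 / ((p.2 : ℝ) + 1)
    · obtain ⟨b, hb, hb'⟩ := hp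
      exact ⟨b, hb, fun _ => hb'⟩
    · exact ⟨a₀, ha₀, fun h => absurd h hp⟩
  choose f hf hf' using key
  refine densChar_le_of_dense (D := range f) ?_ ?_ ?_
  · rintro _ ⟨p, rfl⟩
    exact subset_closure (hf p)
  · intro a ha
    rw [Metric.mem_closure_iff]
    intro ε hε
    obtain ⟨n, hn⟩ := exists_nat_one_div_lt (half_pos hε)
    obtain ⟨d, hd, had⟩ := Metric.mem_closure_iff.1 (h2 (h ha)) _ (Nat.one_div_pos_of_nat (n := n))
    refine ⟨_, ⟨(⟨d, hd⟩, n), rfl⟩, ?_⟩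
    have h1 := hf' (⟨d, hd⟩, n) ⟨a, ha, had⟩
    calc dist a _ ≤ dist a d + dist d _ := dist_triangle _ _ _
      _ < ε / 2 + ε / 2 := by
          refine add_lt_add (had.trans hn) ?_
          rw [dist_comm]
          exact h1.trans hn
      _ = ε := add_halves ε
  · refine mk_range_le.trans ?_
    rw [mk_prod, lift_uzero, mk_nat, lift_aleph0]
    exact (mul_le_mul' (h3.le.trans hB) hκ).trans (mul_eq_self hκ).le

theorem densChar_image_le [TopologicalSpace X] [TopologicalSpace Y] {f : X → Y}
    (hf : Continuous f) (A : Set X) : densChar (f '' A) ≤ densChar A := by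
  obtain ⟨D, h1, h2, h3⟩ := exists_dense_mk_eq_densChar A
  refine densChar_le_of_dense (D := f '' D)
    ((image_mono h1).trans (image_closure_subset_closure_image hf))
    ((image_mono (subset_closure.trans h2)).trans (image_closure_subset_closure_image hf))
    (mk_image_le.trans h3.le)

/-- Completeness of `X` makes the range closed, so a dense subset of its closure consists of values
of `f` and can be pulled back. -/
theorem densChar_range_of_isometry [MetricSpace X] [CompleteSpace X] [MetricSpace Y] {f : X → Y}
    (hf : Isometry f) : densChar (range f) = densChar (univ : Set X) := by
  refine le_antisymm (image_univ (f := f) ▸ densChar_image_le hf.continuous univ) ?_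
  obtain ⟨D, h1, h2, h3⟩ := exists_dense_mk_eq_densChar (range f)
  rw [hf.isClosedEmbedding.isClosed_range.closure_eq] at h1 h2
  refine densChar_le_of_dense (D := f ⁻¹' D) (by simp) (fun x _ => ?_)
    ((mk_preimage_of_injective f D hf.injective).trans h3.le)
  rw [hf.isClosedEmbedding.isInducing.closure_eq_preimage_closure_image]
  rw [image_preimage_eq_of_subset h1]
  exact h2 (mem_range_self x)

end densChar

/-! ### Isomorphisms and embeddings -/

/-- Embeddings preserve only distances to relations; since relations are closed, this determines
membership as well. -/
theorem MetricStr.mem_rel_iff_infEDist (M : MetricStr.{u} L) {n : ℕ} (R : L.Relations n)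
    (x : Fin n → M.carrier) : x ∈ M.rel R ↔ Metric.infEDist x (M.rel R) = 0 :=
  Metric.mem_iff_infEDist_zero_of_closed (M.isClosed_rel R)

namespace StrIso

variable {M N P : MetricStr.{u} L}

theorem isometry (e : StrIso M N) : Isometry e := e.toIsometryEquiv.isometry

theorem injective (e : StrIso M N) : Function.Injective e := e.toEquiv.injective

theorem surjective (e : StrIso M N) : Function.Surjective e := e.toEquiv.surjective

theorem apply_fn (e : StrIso M N) {n : ℕ} (F : L.Functions n) (x : Fin n → M.carrier) :
    e (M.fn F x) = N.fn F (fun k => e (x k)) := e.map_fn F x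

theorem mem_rel (e : StrIso M N) {n : ℕ} (R : L.Relations n) (x : Fin n → M.carrier) :
    x ∈ M.rel R ↔ (fun k => e (x k)) ∈ N.rel R := e.map_rel R x

/-- The identity. -/
def refl (M : MetricStr.{u} L) : StrIso M M where
  toIsometryEquiv := IsometryEquiv.refl _
  map_fn := fun _ _ => rfl
  map_rel := fun _ _ => Iff.rfl

/-- The inverse isomorphism. -/
def symm (e : StrIso M N) : StrIso N M where
  toIsometryEquiv := e.toIsometryEquiv.symm
  map_fn := fun {n} F x => e.injective <| by
    have h := e.apply_fn F (fun k => e.toIsometryEquiv.symm (x k))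
    have h2 : ∀ y, e (e.toIsometryEquiv.symm y) = y := e.toIsometryEquiv.apply_symm_apply
    simp only [h2] at h
    exact (h2 _).trans h.symm
  map_rel := fun {n} R x => by
    have h := e.mem_rel R (fun k => e.toIsometryEquiv.symm (x k))
    have h2 : ∀ y, e (e.toIsometryEquiv.symm y) = y := e.toIsometryEquiv.apply_symm_apply
    simp only [h2] at h
    exact h.symm

/-- Composition of isomorphisms. -/
def trans (e : StrIso M N) (f : StrIso N P) : StrIso M P where
  toIsometryEquiv := e.toIsometryEquiv.trans f.toIsometryEquiv
  map_fn := fun F x => (congrArg f (e.apply_fn F x)).trans (f.apply_fn F _)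
  map_rel := fun R x => (e.mem_rel R x).trans (f.mem_rel R _)

theorem refl_apply (x : M.carrier) : refl M x = x := rfl

theorem trans_apply (e : StrIso M N) (f : StrIso N P) (x : M.carrier) :
    e.trans f x = f (e x) := rfl

theorem apply_symm_apply (e : StrIso M N) (y : N.carrier) : e (e.symm y) = y :=
  e.toIsometryEquiv.apply_symm_apply y

theorem symm_apply_apply (e : StrIso M N) (x : M.carrier) : e.symm (e x) = x :=
  e.toIsometryEquiv.symm_apply_apply x

theorem symm_apply_eq (e : StrIso M N) {x : M.carrier} {y : N.carrier} :
    e.symm y = x ↔ y = e x :=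
  ⟨fun h => by rw [← h, apply_symm_apply], fun h => by rw [h, symm_apply_apply]⟩

theorem dist_apply (e : StrIso M N) (x y : M.carrier) : dist (e x) (e y) = dist x y :=
  e.isometry.dist_eq x y

theorem image_closure (e : StrIso M N) (A : Set M.carrier) :
    e '' closure A = closure (e '' A) :=
  e.toIsometryEquiv.toHomeomorph.image_closure A

theorem densChar_image (e : StrIso M N) (A : Set M.carrier) :
    densChar (e '' A) = densChar A := by
  refine le_antisymm (densChar_image_le e.isometry.continuous A) ?_
  have h := densChar_image_le e.symm.isometry.continuous (e '' A)
  rwa [image_image, show (fun x => e.symm (e x)) = id from funext e.symm_apply_apply,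
    image_id] at h

theorem isometry_pi {n : ℕ} {X Y : Type u} [MetricSpace X] [MetricSpace Y] {f : X → Y}
    (hf : Isometry f) : Isometry (fun (x : Fin n → X) k => f (x k)) :=
  Isometry.piMap (fun _ => f) fun _ => hf

theorem infEDist_rel (e : StrIso M N) {n : ℕ} (R : L.Relations n) (x : Fin n → M.carrier) :
    Metric.infEDist x (M.rel R) = Metric.infEDist (fun k => e (x k)) (N.rel R) := by
  have h : (fun (x : Fin n → M.carrier) k => e (x k)) '' M.rel R = N.rel R := by
    ext y
    constructor
    · rintro ⟨z, hz, rfl⟩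
      exact (e.mem_rel R z).1 hz
    · intro hy
      exact ⟨fun k => e.symm (y k), (e.mem_rel R _).2 (by simpa only [apply_symm_apply] using hy),
        by simp only [apply_symm_apply]⟩
  rw [← h]
  exact (Metric.infEDist_image (isometry_pi e.isometry)).symm

end StrIso

/-- The image of a substructure under a map which preserves the structure. -/
def SubStr.image {M N : MetricStr.{u} L} (f : M.carrier → N.carrier) (hf : Isometry f)
    (hfn : ∀ {n : ℕ} (F : L.Functions n) (x : Fin n → M.carrier),
      f (M.fn F x) = N.fn F (fun k => f (x k)))
    (hrel : ∀ {n : ℕ} (R : L.Relations n) (x : Fin n → M.carrier),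
      Metric.infEDist x (M.rel R) = Metric.infEDist (fun k => f (x k)) (N.rel R))
    (S : SubStr M) : SubStr N where
  carrier := f '' S.carrier
  isClosed := hf.isClosedEmbedding.isClosedMap _ S.isClosed
  fn_mem := fun F x hx => by
    choose y hy hyx using hx
    obtain rfl : (fun k => f (y k)) = x := funext hyx
    exact ⟨_, S.fn_mem F y hy, hfn F y⟩
  rel_dist := fun {n} R x hx => by
    choose y hy hyx using hx
    obtain rfl : (fun k => f (y k)) = x := funext hyx
    have h : (fun (x : Fin n → M.carrier) k => f (x k)) '' {z | z ∈ M.rel R ∧ ∀ k, z k ∈ S.carrier}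
        = {z | z ∈ N.rel R ∧ ∀ k, z k ∈ f '' S.carrier} := by
      ext z
      constructor
      · rintro ⟨t, ⟨ht1, ht2⟩, rfl⟩
        refine ⟨?_, fun k => mem_image_of_mem f (ht2 k)⟩
        rw [N.mem_rel_iff_infEDist, ← hrel, ← M.mem_rel_iff_infEDist]
        exact ht1
      · rintro ⟨ht1, ht2⟩
        choose t ht htz using ht2
        obtain rfl : (fun k => f (t k)) = z := funext htz
        rw [N.mem_rel_iff_infEDist, ← hrel, ← M.mem_rel_iff_infEDist] at ht1
        exact ⟨t, ⟨ht1, ht⟩, rfl⟩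
    rw [← h, ← hrel R y, ← S.rel_dist R y hy]
    exact Metric.infEDist_image (StrIso.isometry_pi hf)

/-- A map which preserves the structure is an isomorphism onto its image. -/
noncomputable def StrIso.ofRange {M N : MetricStr.{u} L} (f : M.carrier → N.carrier)
    (hf : Isometry f)
    (hfn : ∀ {n : ℕ} (F : L.Functions n) (x : Fin n → M.carrier),
      f (M.fn F x) = N.fn F (fun k => f (x k)))
    (hrel : ∀ {n : ℕ} (R : L.Relations n) (x : Fin n → M.carrier),
      Metric.infEDist x (M.rel R) = Metric.infEDist (fun k => f (x k)) (N.rel R))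
    (S : SubStr N) (hS : S.carrier = range f) : StrIso M S.toStr where
  toFun := fun x => ⟨f x, hS ▸ mem_range_self x⟩
  invFun := fun y => (show y.1 ∈ range f from hS ▸ y.2).choose
  left_inv := fun x => hf.injective
    (show f x ∈ range f from mem_range_self x).choose_spec
  right_inv := fun y => Subtype.ext (show y.1 ∈ range f from hS ▸ y.2).choose_spec
  isometry_toFun := fun x y => hf x y
  map_fn := fun F x => Subtype.ext (hfn F x)
  map_rel := fun R x => by
    rw [M.mem_rel_iff_infEDist, hrel, ← N.mem_rel_iff_infEDist]
    rfl

theorem SubStr.infEDist_rel {N : MetricStr.{u} L} (S : SubStr N) {n : ℕ} (R : L.Relations n)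
    (x : Fin n → S.toStr.carrier) :
    Metric.infEDist x (S.toStr.rel R) = Metric.infEDist (fun k => (x k).1) (N.rel R) := by
  rw [← S.rel_dist R (fun k => (x k).1) fun k => (x k).2]
  have h : (fun (x : Fin n → S.toStr.carrier) k => (x k).1) '' S.toStr.rel R =
      {z | z ∈ N.rel R ∧ ∀ k, z k ∈ S.carrier} := by
    ext z
    constructor
    · rintro ⟨t, ht, rfl⟩
      exact ⟨ht, fun k => (t k).2⟩
    · rintro ⟨h1, h2⟩
      exact ⟨fun k => ⟨z k, h2 k⟩, h1, rfl⟩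
  rw [← h]
  exact (Metric.infEDist_image (StrIso.isometry_pi isometry_subtype_coe)).symm

namespace MAEC

variable {K : MAEC.{u} L} {M N P : MetricStr.{u} L}

theorem isEmb_val (S : SubStr N) (hS : K.Strong S) :
    K.IsEmb (M := S.toStr) (N := N) Subtype.val where
  isometry := isometry_subtype_coe
  map_fn := fun _ _ => rfl
  map_rel := fun R x => S.infEDist_rel R x
  strong_range := ⟨S, Subtype.range_coe.symm, hS⟩

theorem isEmb_strIso (e : StrIso M N) (hM : K.Mem M) : K.IsEmb e where
  isometry := e.isometry
  map_fn := e.apply_fn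
  map_rel := e.infEDist_rel
  strong_range := by
    refine ⟨⟨univ, isClosed_univ, fun _ _ _ => trivial, fun R x _ => by simp⟩,
      e.surjective.range_eq.symm, ?_⟩
    exact K.strong_refl _ (K.mem_iso e hM) rfl

end MAEC

namespace StrClass.IsEmb

variable {K : MAEC.{u} L} {M N P : MetricStr.{u} L}

/-- `g` is an isomorphism onto its strong range, so the image is strong in that range, and
transitivity finishes. -/
theorem strong_image {g : N.carrier → P.carrier} (hg : K.IsEmb g) {S : SubStr N}
    (hS : K.Strong S) :
    K.Strong (SubStr.image g hg.isometry hg.map_fn hg.map_rel S) := by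
  obtain ⟨S', hS', hS'2⟩ := hg.strong_range
  have hle : (SubStr.image g hg.isometry hg.map_fn hg.map_rel S).carrier ⊆ S'.carrier := by
    rw [hS']; exact image_subset_range _ _
  refine K.strong_trans _ S' hle (K.strong_iso
    (StrIso.ofRange g hg.isometry hg.map_fn hg.map_rel S' hS') S _ ?_ hS) hS'2
  ext y
  constructor
  · rintro ⟨x, hx, hxy⟩
    exact ⟨x, hx, Subtype.ext hxy⟩
  · rintro ⟨x, hx, rfl⟩
    exact ⟨x, hx, rfl⟩

theorem comp {g : N.carrier → P.carrier} {f : M.carrier → N.carrier} (hg : K.IsEmb g)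
    (hf : K.IsEmb f) : K.IsEmb (M := M) (N := P) (fun x => g (f x)) where
  isometry := hg.isometry.comp hf.isometry
  map_fn := fun F x => by rw [hf.map_fn, hg.map_fn]
  map_rel := fun R x => (hf.map_rel R x).trans (hg.map_rel R _)
  strong_range := by
    obtain ⟨S, hS, hS2⟩ := hf.strong_range
    refine ⟨_, ?_, hg.strong_image hS2⟩
    change g '' S.carrier = _
    rw [hS, ← range_comp]
    rfl

/-- Strength of the range in the smaller codomain is exactly coherence. -/
theorem codRestrict {f : M.carrier → N.carrier} (hf : K.IsEmb f) {S : SubStr N}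
    (hS : K.Strong S) (h : ∀ x, f x ∈ S.carrier) :
    K.IsEmb (M := M) (N := S.toStr) (fun x => ⟨f x, h x⟩) where
  isometry := fun x y => hf.isometry x y
  map_fn := fun F x => Subtype.ext (hf.map_fn F x)
  map_rel := fun R x => (hf.map_rel R x).trans (S.infEDist_rel R fun k => ⟨f (x k), h (x k)⟩).symm
  strong_range := by
    obtain ⟨T, hT, hT2⟩ := hf.strong_range
    have hle : T.carrier ⊆ S.carrier := by
      rw [hT]; rintro _ ⟨x, rfl⟩; exact h x
    refine ⟨T.restrict S hle, ?_, K.coherence T S hle hS hT2⟩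
    ext y
    change y.1 ∈ T.carrier ↔ _
    rw [hT]
    exact ⟨fun ⟨x, hx⟩ => ⟨x, Subtype.ext hx⟩, fun ⟨x, hx⟩ => ⟨x, congrArg Subtype.val hx⟩⟩

end StrClass.IsEmb

/-! ### Models inside the monster model -/

section Models

variable {K : MAEC.{u} L} {𝕄 : MetricStr.{u} L} {μ : Cardinal.{u}}

namespace Model

theorem le_def {A B : Model K 𝕄} : A ≤ B ↔ A.set ⊆ B.set := Iff.rfl

theorem le_refl (A : Model K 𝕄) : A ≤ A := Subset.rfl

theorem le_trans {A B C : Model K 𝕄} (h : A ≤ B) (h' : B ≤ C) : A ≤ C := Subset.trans h h'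

theorem isClosed_set (A : Model K 𝕄) : IsClosed A.set := A.toSub.isClosed

theorem eq_of_set_eq {A B : Model K 𝕄} (h : A.set = B.set) : A = B :=
  Model.ext (SubStr.ext h)

theorem mem_toStr (A : Model K 𝕄) : K.Mem A.toStr := (K.mem_of_strong _ A.strong).2

theorem dc_toStr (A : Model K 𝕄) : A.toStr.dc = A.dc := by
  have h := densChar_range_of_isometry (X := A.toStr.carrier) (Y := 𝕄.carrier)
    (f := Subtype.val) isometry_subtype_coe
  exact h.symm.trans (congrArg densChar Subtype.range_coe)

/-- The image of a model under an automorphism. -/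
def map (g : StrIso 𝕄 𝕄) (A : Model K 𝕄) : Model K 𝕄 :=
  ⟨SubStr.image g g.isometry g.apply_fn g.infEDist_rel A.toSub,
    K.strong_iso g A.toSub _ rfl A.strong⟩

theorem map_set (g : StrIso 𝕄 𝕄) (A : Model K 𝕄) : (A.map g).set = g '' A.set := rfl

theorem apply_mem_map {g : StrIso 𝕄 𝕄} {A : Model K 𝕄} {x : 𝕄.carrier} :
    g x ∈ (A.map g).set ↔ x ∈ A.set := g.injective.mem_set_image

theorem mem_map_iff {g : StrIso 𝕄 𝕄} {A : Model K 𝕄} {x : 𝕄.carrier} :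
    x ∈ (A.map g).set ↔ g.symm x ∈ A.set := by
  have h := apply_mem_map (g := g) (A := A) (x := g.symm x)
  rwa [StrIso.apply_symm_apply] at h

theorem dc_map (g : StrIso 𝕄 𝕄) (A : Model K 𝕄) : (A.map g).dc = A.dc := g.densChar_image _

theorem map_mono {g : StrIso 𝕄 𝕄} {A B : Model K 𝕄} (h : A ≤ B) : A.map g ≤ B.map g :=
  image_mono h

theorem map_congr {g g' : StrIso 𝕄 𝕄} {A : Model K 𝕄} (h : ∀ x ∈ A.set, g x = g' x) :
    A.map g = A.map g' :=
  eq_of_set_eq (image_congr h)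

theorem map_trans (g g' : StrIso 𝕄 𝕄) (A : Model K 𝕄) : A.map (g.trans g') = (A.map g).map g' :=
  eq_of_set_eq (image_comp g' g A.set)

theorem map_refl (A : Model K 𝕄) : A.map (StrIso.refl 𝕄) = A := eq_of_set_eq (image_id A.set)

theorem map_eq_self {g : StrIso 𝕄 𝕄} {A : Model K 𝕄} (h : ∀ x ∈ A.set, g x = x) :
    A.map g = A := (map_congr (g' := StrIso.refl 𝕄) h).trans A.map_refl

theorem map_symm_map (g : StrIso 𝕄 𝕄) (A : Model K 𝕄) : (A.map g).map g.symm = A := by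
  rw [← map_trans]
  exact map_eq_self fun x _ => g.symm_apply_apply x

theorem le_map_of_fixes {g : StrIso 𝕄 𝕄} {A B : Model K 𝕄} (h : ∀ x ∈ A.set, g x = x)
    (hAB : A ≤ B) : A ≤ B.map g := by
  have := map_mono (g := g) hAB
  rwa [map_eq_self h] at this

theorem isEmb_val (A : Model K 𝕄) : K.IsEmb (M := A.toStr) (N := 𝕄) Subtype.val :=
  MAEC.isEmb_val _ A.strong

theorem dc_le_of_le (hμ : ℵ₀ ≤ μ) {A B : Model K 𝕄} (h : A ≤ B) (hB : B.dc ≤ μ) : A.dc ≤ μ :=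
  densChar_mono_of_le hμ (Subset.trans h subset_closure) hB

/-- Heredity of the density character is available only for bounds that are at least ℵ₀, so the
contradiction goes through `max B.dc ℵ₀`; this needs μ uncountable. -/
theorem dc_eq_of_le (hμ : ℵ₀ < μ) {A B : Model K 𝕄} (h : A ≤ B) (hA : A.dc = μ) (hB : B.dc ≤ μ) :
    B.dc = μ := by
  by_contra hne
  have h1 : max B.dc ℵ₀ < μ := max_lt (lt_of_le_of_ne hB hne) hμ
  exact absurd (dc_le_of_le (le_max_right _ _) h (le_max_left B.dc ℵ₀)) (by rw [hA]; exact h1.not_ge)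

theorem exists_chain_union {ι : Type u} [LinearOrder ι] [WellFoundedLT ι] [Nonempty ι]
    (S : ι → Model K 𝕄) (h : ∀ i j, i ≤ j → S i ≤ S j) :
    ∃ U : Model K 𝕄, U.set = closure (⋃ i, (S i).set) := by
  obtain ⟨U, hU, hU2⟩ := K.chain_strong (fun i => (S i).toSub) (fun i => (S i).strong) h
  exact ⟨⟨U, hU2⟩, hU⟩

end Model

/-- The standing assumptions on the monster model and the cardinal `μ`. -/
structure Setting (K : MAEC.{u} L) (𝕄 : MetricStr.{u} L) (μ : Cardinal.{u}) : Prop where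
  monster : IsMonster K 𝕄
  aleph0_lt : ℵ₀ < μ
  LS_le : K.LS ≤ μ
  lt_dc : μ < 𝕄.dc

theorem IsMonster.exists_extension (h𝕄 : IsMonster K 𝕄) {A : Model K 𝕄} (hA : A.dc < 𝕄.dc)
    {f : A.toStr.carrier → 𝕄.carrier} (hf : K.IsEmb f) :
    ∃ g : StrIso 𝕄 𝕄, ∀ x : A.toStr.carrier, g x.1 = f x := by
  obtain ⟨S, hS, hS2⟩ := hf.strong_range
  obtain ⟨g, hg⟩ := h𝕄.homogeneous A ⟨S, hS2⟩ hA
    (StrIso.ofRange f hf.isometry hf.map_fn hf.map_rel S hS)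
  exact ⟨g, hg⟩

namespace Setting

variable (s : Setting K 𝕄 μ)
include s

theorem exists_model_ge {A : Model K 𝕄} (hA : A.dc = μ) {R : Set 𝕄.carrier}
    (hR : densChar R ≤ μ) : ∃ P : Model K 𝕄, P.dc = μ ∧ A ≤ P ∧ R ⊆ P.set := by
  obtain ⟨S, hS, hS2, hS3⟩ := K.downward (A.set ∪ R) s.monster.mem
  have hle : densChar S.carrier ≤ μ := hS3.trans <|
    (add_le_add (densChar_union_le s.aleph0_lt.le hA.le hR) s.LS_le).trans
      (add_eq_self s.aleph0_lt.le).le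
  have h1 : A ≤ (⟨S, hS⟩ : Model K 𝕄) := Subset.trans subset_union_left hS2
  exact ⟨⟨S, hS⟩, Model.dc_eq_of_le s.aleph0_lt h1 hA hle, h1, subset_union_right.trans hS2⟩

/-- Replaces abstract extensions by models inside `𝕄` and embeddings by automorphisms, the form used
in all later arguments. Universality of `𝕄` realizes an abstract extension, and homogeneity moves it
so that it lies over `A`. -/
theorem isUniversalOver_iff {A B : Model K 𝕄} (hA : A.dc = μ) :
    IsUniversalOver μ A B ↔ A ≤ B ∧ ∀ P : Model K 𝕄, A ≤ P → P.dc = μ →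
      ∃ g : StrIso 𝕄 𝕄, (∀ x ∈ A.set, g x = x) ∧ P.map g ≤ B := by
  refine and_congr_right fun hAB => ⟨fun H P hP hPμ => ?_, fun H N' e hN' he hdc => ?_⟩
  · obtain ⟨f, hf, hfx⟩ := H P.toStr (fun x => ⟨x.1, hP x.2⟩) P.mem_toStr
      (A.isEmb_val.codRestrict P.strong fun x => hP x.2) (P.dc_toStr.trans hPμ)
    obtain ⟨g, hg⟩ := s.monster.exists_extension (hPμ ▸ s.lt_dc) (B.isEmb_val.comp hf)
    refine ⟨g, fun x hx => (hg ⟨x, hP hx⟩).trans (hfx ⟨x, hx⟩), ?_⟩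
    rintro _ ⟨x, hx, rfl⟩
    rw [hg ⟨x, hx⟩]
    exact (f ⟨x, hx⟩).2
  · obtain ⟨f, hf⟩ := s.monster.universal N' hN' (hdc ▸ s.lt_dc)
    obtain ⟨θ, hθ⟩ := s.monster.exists_extension (hA ▸ s.lt_dc) (hf.comp he)
    have hv := (MAEC.isEmb_strIso (K := K) θ.symm s.monster.mem).comp hf
    have hve : ∀ x : A.toStr.carrier, θ.symm (f (e x)) = x.1 := fun x => by
      rw [← hθ x, StrIso.symm_apply_apply]
    obtain ⟨S, hS, hS2⟩ := hv.strong_range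
    obtain ⟨g, hg, hgB⟩ := H ⟨S, hS2⟩ (fun x hx => by
      change x ∈ S.carrier
      rw [hS]
      exact ⟨e ⟨x, hx⟩, hve ⟨x, hx⟩⟩) (by
      change densChar S.carrier = μ
      rw [hS, densChar_range_of_isometry hv.isometry]
      exact hdc)
    have hw := (MAEC.isEmb_strIso (K := K) g s.monster.mem).comp hv
    have hwB : ∀ x, g (θ.symm (f x)) ∈ B.set := fun x => hgB ⟨_, by
      change _ ∈ S.carrier
      rw [hS]
      exact mem_range_self x, rfl⟩
    refine ⟨_, hw.codRestrict B.strong hwB, fun x => ?_⟩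
    change g (θ.symm (f (e x))) = x.1
    rw [hve]
    exact hg _ x.2

theorem isUniversalOver_mono {A A' B B' : Model K 𝕄} (hA : A.dc = μ) (hA' : A'.dc = μ)
    (hAA : A' ≤ A) (hBB : B ≤ B') (h : IsUniversalOver μ A B) : IsUniversalOver μ A' B' := by
  rw [s.isUniversalOver_iff hA] at h
  rw [s.isUniversalOver_iff hA']
  refine ⟨Model.le_trans hAA (Model.le_trans h.1 hBB), fun P _ hPμ => ?_⟩
  -- `P` contains `A'` but perhaps not `A`, so it is first enlarged to a model over `A`.
  obtain ⟨Q, hQ, hAQ, hPQ⟩ := s.exists_model_ge hA (R := P.set) hPμ.le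
  obtain ⟨g, hg, hgB⟩ := h.2 Q hAQ hQ
  exact ⟨g, fun x hx => hg x (hAA hx),
    Model.le_trans (Model.map_mono hPQ) (Model.le_trans hgB hBB)⟩

theorem isUniversalOver_map {A B : Model K 𝕄} (hA : A.dc = μ) (h : IsUniversalOver μ A B)
    (g : StrIso 𝕄 𝕄) : IsUniversalOver μ (A.map g) (B.map g) := by
  rw [s.isUniversalOver_iff hA] at h
  rw [s.isUniversalOver_iff (A.dc_map g ▸ hA)]
  refine ⟨Model.map_mono h.1, fun P hAP hPμ => ?_⟩
  obtain ⟨f, hf, hfB⟩ := h.2 (P.map g.symm)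
    (by have := Model.map_mono (g := g.symm) hAP; rwa [Model.map_symm_map] at this)
    ((P.dc_map _).trans hPμ)
  refine ⟨(g.symm.trans f).trans g, ?_, ?_⟩
  · rintro _ ⟨x, hx, rfl⟩
    rw [StrIso.trans_apply, StrIso.trans_apply, StrIso.symm_apply_apply, hf x hx]
  · rw [Model.map_trans, Model.map_trans]
    exact Model.map_mono hfB

/-- Two consecutive universal extensions suffice to produce one over any model. A model `P`
containing `A`, `A₀` and `R` embeds over `A₀` into `A₁`, so `A₂` is universal over the image of `P`;
the embedding is then undone. -/
theorem exists_universal_of_exists {A₀ A₁ A₂ : Model K 𝕄} (h0 : A₀.dc = μ) (h1 : A₁.dc = μ)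
    (h2 : A₂.dc = μ) (h01 : IsUniversalOver μ A₀ A₁) (h12 : IsUniversalOver μ A₁ A₂)
    {A : Model K 𝕄} (hA : A.dc = μ) {R : Set 𝕄.carrier} (hR : densChar R ≤ μ) :
    ∃ B : Model K 𝕄, B.dc = μ ∧ IsUniversalOver μ A B ∧ R ⊆ B.set := by
  obtain ⟨P, hP, hAP, hRP⟩ := s.exists_model_ge hA
    (densChar_union_le s.aleph0_lt.le hR (show densChar A₀.set ≤ μ from h0.le))
  rw [s.isUniversalOver_iff h0] at h01
  obtain ⟨g, -, hg⟩ := h01.2 P (subset_union_right.trans hRP) hP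
  have hU := s.isUniversalOver_map ((P.dc_map g).trans hP)
    (s.isUniversalOver_mono h1 ((P.dc_map g).trans hP) hg A₂.le_refl h12) g.symm
  rw [Model.map_symm_map] at hU
  exact ⟨_, (A₂.dc_map _).trans h2, s.isUniversalOver_mono hP hA hAP (Model.le_refl _) hU,
    (subset_union_left.trans hRP).trans hU.1⟩

theorem exists_notMem {A : Model K 𝕄} (hA : A.dc = μ) : ∃ x, x ∉ A.set := by
  by_contra! h
  have h1 : A.set = Set.univ := eq_univ_of_forall h
  have h2 : 𝕄.dc = μ := by rw [← hA, Model.dc, h1]; rfl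
  exact s.lt_dc.ne h2.symm

theorem ne_of_isUniversalOver {A B : Model K 𝕄} (hA : A.dc = μ) (h : IsUniversalOver μ A B) :
    A ≠ B := by
  rintro rfl
  obtain ⟨x, hx⟩ := s.exists_notMem hA
  obtain ⟨P, hP, hAP, hxP⟩ := s.exists_model_ge hA (R := {x})
    (densChar_le_of_dense subset_closure subset_closure
      ((mk_singleton x).le.trans (one_le_aleph0.trans s.aleph0_lt.le)))
  -- If `A` were universal over itself, `g` would send `x` into `A`, where `g` is the identity;
  -- injectivity then gives `g x = x`.
  obtain ⟨g, hg, hgA⟩ := ((s.isUniversalOver_iff hA).1 h).2 P hAP hP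
  have h1 : g x ∈ A.set := hgA ⟨x, hxP rfl, rfl⟩
  exact hx (g.injective (hg _ h1) ▸ h1)

end Setting

end Models

/-! ### Chains indexed by ordinals and limit models -/

section Chains

variable {K : MAEC.{u} L} {𝕄 : MetricStr.{u} L} {μ : Cardinal.{u}}

/-- An increasing continuous chain of models of density character `μ`, of length `θ + 1`. -/
structure IsContChain (μ : Cardinal.{u}) (F : Ordinal.{u} → Model K 𝕄) (θ : Ordinal.{u}) :
    Prop where
  dc_eq : ∀ α ≤ θ, (F α).dc = μ
  mono : ∀ α β, α ≤ β → β ≤ θ → F α ≤ F β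
  cont : ∀ γ ≤ θ, Order.IsSuccLimit γ → (F γ).set = closure (⋃ β : Iio γ, (F β.1).set)

/-- The first `θ` terms of a function on the ordinals. -/
def ModelSeq.ofFun (F : Ordinal.{u} → Model K 𝕄) (θ : Ordinal.{u}) : ModelSeq K 𝕄 :=
  ⟨θ, fun γ => F γ.1⟩

/-- The image of a sequence of models under an automorphism. -/
def ModelSeq.map (g : StrIso 𝕄 𝕄) (r : ModelSeq K 𝕄) : ModelSeq K 𝕄 :=
  ⟨r.length, fun γ => (r.seq γ).map g⟩

theorem ModelSeq.isResolution_of_subset {r : ModelSeq K 𝕄} {A : Model K 𝕄}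
    (mono : ∀ β γ, β ≤ γ → r.seq β ≤ r.seq γ)
    (cont : ∀ γ : Iio r.length, Order.IsSuccLimit γ.1 →
      (r.seq γ).set ⊆ closure (⋃ β : {β // β < γ}, (r.seq β.1).set))
    (le : ∀ γ, r.seq γ ≤ A) (subset : A.set ⊆ closure (⋃ γ, (r.seq γ).set))
    (dc_eq : ∀ γ, (r.seq γ).dc = μ) : r.IsResolution μ A where
  mono := mono
  cont := fun γ hγ => (cont γ hγ).antisymm
    (closure_minimal (iUnion_subset fun β => mono _ _ β.2.le) (Model.isClosed_set _))
  union := subset.antisymm (closure_minimal (iUnion_subset le) A.isClosed_set)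
  dc_eq := dc_eq

theorem ModelSeq.IsResolution.le {r : ModelSeq K 𝕄} {A : Model K 𝕄} (h : r.IsResolution μ A)
    (γ : Iio r.length) : r.seq γ ≤ A := by
  rw [Model.le_def, h.union]
  exact (subset_iUnion (fun γ => (r.seq γ).set) γ).trans subset_closure

theorem ModelSeq.IsResolution.map {r : ModelSeq K 𝕄} {A : Model K 𝕄} (h : r.IsResolution μ A)
    (g : StrIso 𝕄 𝕄) : (r.map g).IsResolution μ (A.map g) where
  mono := fun β γ hβγ => Model.map_mono (h.mono β γ hβγ)
  cont := fun γ hγ => by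
    change g '' (r.seq γ).set = closure (⋃ β : {β // β < γ}, g '' (r.seq β.1).set)
    rw [h.cont γ hγ, StrIso.image_closure, image_iUnion]
    rfl
  union := by
    change g '' A.set = closure (⋃ γ : Iio r.length, g '' (r.seq γ).set)
    rw [h.union, StrIso.image_closure, image_iUnion]
  dc_eq := fun γ => (Model.dc_map _ _).trans (h.dc_eq γ)

theorem IsContChain.isResolution {F : Ordinal.{u} → Model K 𝕄} {θ : Ordinal.{u}}
    (h : IsContChain μ F θ) (hθ : Order.IsSuccLimit θ) :
    (ModelSeq.ofFun F θ).IsResolution μ (F θ) :=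
  ModelSeq.isResolution_of_subset (fun β γ hβγ => h.mono _ _ hβγ γ.2.le)
    (fun γ hγ => by
      change (F γ.1).set ⊆ closure (⋃ β : {β : Iio θ // β < γ}, (F β.1.1).set)
      rw [h.cont γ.1 γ.2.le hγ]
      refine closure_mono (iUnion_subset fun β => ?_)
      exact subset_iUnion_of_subset ⟨⟨β.1, lt_trans (mem_Iio.1 β.2) (mem_Iio.1 γ.2)⟩, β.2⟩ Subset.rfl)
    (fun γ => h.mono _ _ γ.2.le le_rfl) (h.cont θ le_rfl hθ).subset
    (fun γ => h.dc_eq _ γ.2.le)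

theorem IsContChain.isLimitModel {F : Ordinal.{u} → Model K 𝕄} {θ : Ordinal.{u}}
    (h : IsContChain μ F θ) (hθ : Order.IsSuccLimit θ)
    (hu : ∀ α < θ, IsUniversalOver μ (F α) (F (α + 1))) : IsLimitModel μ θ (F 0) (F θ) := by
  refine ⟨ModelSeq.ofFun F θ, rfl, h.isResolution hθ, hθ, ?_, ?_⟩
  · intro γ hγ
    exact congrArg F hγ
  · intro γ δ hδ
    change IsUniversalOver μ (F γ.1) (F δ.1)
    rw [hδ]
    exact hu _ γ.2

/-- The chain axiom takes index types in universe `u`, while `Iio γ` lives one universe higher;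
`γ.ToType` is used in its place. -/
theorem exists_model_iUnion_Iio {F : Ordinal.{u} → Model K 𝕄} {γ : Ordinal.{u}} (hγ : γ ≠ 0)
    (h : ∀ α β, α ≤ β → β < γ → F α ≤ F β) :
    ∃ U : Model K 𝕄, U.set = closure (⋃ β : Iio γ, (F β.1).set) := by
  have : Nonempty γ.ToType := Ordinal.nonempty_toType_iff.2 hγ
  obtain ⟨U, hU⟩ := Model.exists_chain_union (fun i : γ.ToType => F (Ordinal.ToType.mk.symm i).1)
    fun i j hij => h _ _ (by simpa using hij) (Ordinal.ToType.mk.symm j).2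
  refine ⟨U, hU.trans (congrArg closure ?_)⟩
  exact Ordinal.ToType.mk.symm.surjective.iUnion_comp fun β : Iio γ => (F β.1).set

theorem densChar_iUnion_Iio_le {X : Type u} [TopologicalSpace X] {γ : Ordinal.{u}}
    {A : Iio γ → Set X} (hμ : ℵ₀ ≤ μ) (hγ : γ.card ≤ μ) (hA : ∀ β, densChar (A β) ≤ μ) :
    densChar (⋃ β, A β) ≤ μ := by
  rw [← Ordinal.ToType.mk.symm.surjective.iUnion_comp A]
  exact densChar_iUnion_le hμ ((mk_toType γ).trans_le hγ) fun i => hA _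

open Classical in
/-- The continuous chain obtained by iterating a map on models. -/
noncomputable def iterChain (step : Model K 𝕄 → Model K 𝕄) (A : Model K 𝕄) (α : Ordinal.{u}) :
    Model K 𝕄 :=
  Ordinal.limitRecOn α A (fun _ B => step B) fun γ _ F =>
    if h : ∃ U : Model K 𝕄, U.set = closure (⋃ β : Iio γ, (F β.1 β.2).set) then h.choose else A

theorem iterChain_zero (step : Model K 𝕄 → Model K 𝕄) (A : Model K 𝕄) :
    iterChain step A 0 = A := Ordinal.limitRecOn_zero ..

theorem iterChain_add_one (step : Model K 𝕄 → Model K 𝕄) (A : Model K 𝕄) (α : Ordinal.{u}) :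
    iterChain step A (α + 1) = step (iterChain step A α) := Ordinal.limitRecOn_add_one ..

theorem iterChain_limit (step : Model K 𝕄 → Model K 𝕄) (A : Model K 𝕄) {γ : Ordinal.{u}}
    (hγ : Order.IsSuccLimit γ)
    (h : ∀ α β, α ≤ β → β < γ → iterChain step A α ≤ iterChain step A β) :
    (iterChain step A γ).set = closure (⋃ β : Iio γ, (iterChain step A β.1).set) := by
  have h1 := exists_model_iUnion_Iio hγ.ne_bot h
  have h2 : iterChain step A γ = h1.choose := by
    rw [iterChain, Ordinal.limitRecOn_limit _ _ _ _ hγ]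
    exact dif_pos h1
  rw [h2]
  exact h1.choose_spec

/-- Induction on the length of the whole chain, because the value at a limit is the intended union
only once the chain below is known to increase. -/
theorem iterChain_isContChain (hμ : ℵ₀ < μ) {step : Model K 𝕄 → Model K 𝕄}
    (hstep : ∀ A : Model K 𝕄, A.dc = μ → (step A).dc = μ ∧ A ≤ step A) {A : Model K 𝕄}
    (hA : A.dc = μ) {θ : Ordinal.{u}} (hθ : θ.card ≤ μ) : IsContChain μ (iterChain step A) θ := by
  induction θ using Ordinal.limitRecOn with
  | zero =>
    refine ⟨?_, ?_, ?_⟩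
    · intro α hα
      rw [nonpos_iff_eq_zero.1 hα, iterChain_zero, hA]
    · intro α β hα hβ
      rw [nonpos_iff_eq_zero.1 hβ, nonpos_iff_eq_zero.1 (hα.trans hβ)]
      exact Model.le_refl _
    · intro γ hγ hγ'
      exact absurd (nonpos_iff_eq_zero.1 hγ) hγ'.ne_bot
  | add_one θ ih =>
    have ih := ih ((Ordinal.card_le_card (by simp)).trans hθ)
    obtain ⟨h1, h2⟩ := hstep _ (ih.dc_eq θ le_rfl)
    rw [← iterChain_add_one step A θ] at h1 h2
    have key : ∀ β ≤ θ + 1, β ≤ θ ∨ β = θ + 1 := fun β hβ => by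
      rcases hβ.lt_or_eq with h | h
      · exact Or.inl (Order.lt_add_one_iff.1 h)
      · exact Or.inr h
    refine ⟨?_, ?_, ?_⟩
    · intro α hα
      rcases key α hα with h | rfl
      · exact ih.dc_eq α h
      · exact h1
    · intro α β hα hβ
      rcases key β hβ with h | rfl
      · exact ih.mono α β hα h
      · rcases key α hα with h | rfl
        · exact Model.le_trans (ih.mono α θ h le_rfl) h2
        · exact Model.le_refl _
    · intro γ hγ hγ'
      rcases key γ hγ with h | rfl
      · exact ih.cont γ h hγ'
      · exact absurd hγ' (by simp)
  | limit θ hlim ih =>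
    have ih : ∀ β < θ, IsContChain μ (iterChain step A) β := fun β hβ =>
      ih β hβ ((Ordinal.card_le_card hβ.le).trans hθ)
    have hset := iterChain_limit step A hlim fun α β h1 h2 => (ih β h2).mono α β h1 le_rfl
    have hle : ∀ β < θ, iterChain step A β ≤ iterChain step A θ := fun β hβ => by
      rw [Model.le_def, hset]
      exact (subset_iUnion (fun β : Iio θ => (iterChain step A β.1).set) ⟨β, hβ⟩).trans
        subset_closure
    refine ⟨?_, ?_, ?_⟩
    · intro α hα
      rcases hα.lt_or_eq with h | rfl
      · exact (ih α h).dc_eq α le_rfl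
      · have h0 : (0 : Ordinal.{u}) < α := hlim.bot_lt
        -- The first term bounds the density character from below; a union of at most μ terms bounds
        -- it from above.
        refine Model.dc_eq_of_le hμ (hle 0 h0) ((ih 0 h0).dc_eq 0 le_rfl) ?_
        rw [Model.dc, hset, densChar_closure]
        exact densChar_iUnion_Iio_le hμ.le hθ fun β => ((ih _ β.2).dc_eq _ le_rfl).le
    · intro α β hα hβ
      rcases hβ.lt_or_eq with h | rfl
      · exact (ih β h).mono α β hα le_rfl
      · rcases hα.lt_or_eq with h | rfl
        · exact hle α h
        · exact Model.le_refl _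
    · intro γ hγ hγ'
      rcases hγ.lt_or_eq with h | rfl
      · exact (ih γ h).cont γ le_rfl hγ'
      · exact hset

end Chains

/-! ### Limit models: transport, change of base, existence, prolongation of resolutions -/

section LimitModels

variable {K : MAEC.{u} L} {𝕄 : MetricStr.{u} L} {μ : Cardinal.{u}}

theorem ModelSeq.WitnessesLimit.isUniversalOver (s : Setting K 𝕄 μ) {r : ModelSeq K 𝕄}
    {A B : Model K 𝕄} (h : r.WitnessesLimit μ A B) : A.dc = μ ∧ IsUniversalOver μ A B := by
  have h0 : (0 : Ordinal.{u}) < r.length := h.isLimit.bot_lt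
  have h1 : (0 + 1 : Ordinal.{u}) < r.length := h.isLimit.succ_lt h0
  have hA := h.zero ⟨0, h0⟩ rfl
  have hd := h.resolution.dc_eq ⟨0, h0⟩
  have hu := h.succ ⟨0, h0⟩ ⟨0 + 1, h1⟩ rfl
  rw [hA] at hd hu
  exact ⟨hd, s.isUniversalOver_mono hd hd A.le_refl (h.resolution.le _) hu⟩

theorem IsLimitModel.isUniversalOver (s : Setting K 𝕄 μ) {θ : Ordinal.{u}} {A B : Model K 𝕄}
    (h : IsLimitModel μ θ A B) : IsUniversalOver μ A B := by
  obtain ⟨r, -, hr⟩ := h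
  exact (hr.isUniversalOver s).2

theorem ModelSeq.WitnessesLimit.map (s : Setting K 𝕄 μ) {r : ModelSeq K 𝕄} {A B : Model K 𝕄}
    (h : r.WitnessesLimit μ A B) (g : StrIso 𝕄 𝕄) :
    (r.map g).WitnessesLimit μ (A.map g) (B.map g) where
  resolution := h.resolution.map g
  isLimit := h.isLimit
  zero := fun γ hγ => congrArg (Model.map g) (h.zero γ hγ)
  succ := fun γ δ hδ => s.isUniversalOver_map (h.resolution.dc_eq γ) (h.succ γ δ hδ) g

theorem IsLimitModel.map (s : Setting K 𝕄 μ) {θ : Ordinal.{u}} {A B : Model K 𝕄}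
    (h : IsLimitModel μ θ A B) (g : StrIso 𝕄 𝕄) : IsLimitModel μ θ (A.map g) (B.map g) := by
  obtain ⟨r, rfl, hr⟩ := h
  exact ⟨r.map g, rfl, hr.map s g⟩

theorem ModelSeq.SpreadOut.map (s : Setting K 𝕄 μ) {r : ModelSeq K 𝕄} (h : r.SpreadOut μ)
    (g : StrIso 𝕄 𝕄) : (r.map g).SpreadOut μ :=
  fun γ δ hδ => (h γ δ hδ).map s g

/-- A limit model over `A` is a limit model, of the same length, over the submodels of `A`. -/
theorem IsLimitModel.of_le (s : Setting K 𝕄 μ) {θ : Ordinal.{u}} {A B C : Model K 𝕄}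
    (h : IsLimitModel μ θ A B) (hC : C.dc = μ) (hCA : C ≤ A) : IsLimitModel μ θ C B := by
  classical
  obtain ⟨r, rfl, hr⟩ := h
  let r' : ModelSeq K 𝕄 := ⟨r.length, fun γ => if γ.1 = 0 then C else r.seq γ⟩
  have h0 : ∀ γ : Iio r.length, γ.1 = 0 → r'.seq γ = C := fun γ hγ => if_pos hγ
  have h1 : ∀ γ : Iio r.length, γ.1 ≠ 0 → r'.seq γ = r.seq γ := fun γ hγ => if_neg hγ
  have hle : ∀ γ : Iio r.length, r'.seq γ ≤ r.seq γ := fun γ => by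
    by_cases hγ : γ.1 = 0
    · rw [h0 γ hγ, hr.zero γ hγ]; exact hCA
    · rw [h1 γ hγ]; exact Model.le_refl _
  have hsucc : ∀ γ : Iio r.length, γ.1 + 1 < r.length := fun γ => hr.isLimit.succ_lt γ.2
  -- Shifting by one avoids the altered term at 0, so unions over limit ordinals are unchanged.
  have hle' : ∀ γ : Iio r.length, r.seq γ ≤ r'.seq ⟨γ.1 + 1, hsucc γ⟩ := fun γ => by
    rw [h1 _ (by simp)]
    exact hr.resolution.mono _ _ (by simp [← Subtype.coe_le_coe])
  refine ⟨r', rfl, ModelSeq.isResolution_of_subset ?_ ?_ ?_ ?_ ?_, hr.isLimit, h0, ?_⟩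
  · intro β γ hβγ
    by_cases hγ : γ.1 = 0
    · obtain rfl : β = γ := hβγ.antisymm (by simp [← Subtype.coe_le_coe, hγ])
      exact Model.le_refl _
    · exact Model.le_trans (hle β) (by rw [h1 γ hγ]; exact hr.resolution.mono β γ hβγ)
  · intro γ hγ
    have hγ' : γ.1 ≠ 0 := hγ.ne_bot
    rw [h1 γ hγ', hr.resolution.cont γ hγ]
    refine closure_mono (iUnion_subset fun β => ?_)
    exact subset_iUnion_of_subset ⟨⟨β.1.1 + 1, hsucc _⟩, hγ.succ_lt β.2⟩ (hle' _)
  · exact fun γ => Model.le_trans (hle γ) (hr.resolution.le γ)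
  · rw [hr.resolution.union]
    refine closure_mono (iUnion_subset fun β => ?_)
    exact subset_iUnion_of_subset ⟨β.1 + 1, hsucc _⟩ (hle' _)
  · intro γ
    by_cases hγ : γ.1 = 0
    · rw [h0 γ hγ, hC]
    · rw [h1 γ hγ, hr.resolution.dc_eq]
  · intro γ δ hδ
    have hδ' : δ.1 ≠ 0 := by rw [hδ]; simp
    have hdc : (r'.seq γ).dc = μ := by
      by_cases hγ : γ.1 = 0
      · rw [h0 γ hγ, hC]
      · rw [h1 γ hγ, hr.resolution.dc_eq]
    rw [h1 δ hδ']
    exact s.isUniversalOver_mono (hr.resolution.dc_eq γ) hdc (hle γ) (Model.le_refl _)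
      (hr.succ γ δ hδ)

/-- Existence of universal extensions of density character `μ`. -/
def HasUniversalExtensions (K : MAEC.{u} L) (𝕄 : MetricStr.{u} L) (μ : Cardinal.{u}) : Prop :=
  ∀ (A : Model K 𝕄) (R : Set 𝕄.carrier), A.dc = μ → densChar R ≤ μ →
    ∃ B : Model K 𝕄, B.dc = μ ∧ IsUniversalOver μ A B ∧ R ⊆ B.set

/-- The first three terms of a single limit resolution provide the two universal steps from which
all others are copied. -/
theorem ModelSeq.WitnessesLimit.hasUniversalExtensions (s : Setting K 𝕄 μ) {r : ModelSeq K 𝕄}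
    {A B : Model K 𝕄} (h : r.WitnessesLimit μ A B) : HasUniversalExtensions K 𝕄 μ := by
  have h0 : (0 : Ordinal.{u}) < r.length := h.isLimit.bot_lt
  have h1 : (0 + 1 : Ordinal.{u}) < r.length := h.isLimit.succ_lt h0
  have h2 : (0 + 1 + 1 : Ordinal.{u}) < r.length := h.isLimit.succ_lt h1
  intro C R hC hR
  exact s.exists_universal_of_exists (h.resolution.dc_eq ⟨0, h0⟩)
    (h.resolution.dc_eq ⟨0 + 1, h1⟩) (h.resolution.dc_eq ⟨0 + 1 + 1, h2⟩)
    (h.succ ⟨0, h0⟩ ⟨0 + 1, h1⟩ rfl) (h.succ ⟨0 + 1, h1⟩ ⟨0 + 1 + 1, h2⟩ rfl) hC hR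

namespace Setting

variable (s : Setting K 𝕄 μ)
include s

theorem exists_limitModel (hU : HasUniversalExtensions K 𝕄 μ) {θ : Ordinal.{u}}
    (hθ : Order.IsSuccLimit θ) (hθμ : θ.card ≤ μ) (A : Model K 𝕄) (R : Set 𝕄.carrier)
    (hA : A.dc = μ) (hR : densChar R ≤ μ) :
    ∃ B : Model K 𝕄, B.dc = μ ∧ IsLimitModel μ θ A B ∧ R ⊆ B.set := by
  have : Nonempty (Model K 𝕄) := ⟨A⟩
  have hstep : ∀ A : Model K 𝕄, A.dc = μ → ∃ B : Model K 𝕄, B.dc = μ ∧ IsUniversalOver μ A B :=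
    fun A hA => by
      obtain ⟨B, h1, h2, -⟩ := hU A R hA hR
      exact ⟨B, h1, h2⟩
  choose! step h1 h2 using hstep
  -- `R` is absorbed before the chain starts; the base is lowered from `P` to `A` at the end.
  obtain ⟨P, hP, hAP, hRP⟩ := s.exists_model_ge hA hR
  have hF := iterChain_isContChain s.aleph0_lt (fun A hA => ⟨h1 A hA, (h2 A hA).1⟩) hP hθμ
  have hlim := hF.isLimitModel hθ fun α hα => by
    rw [iterChain_add_one]
    exact h2 _ (hF.dc_eq α hα.le)
  rw [iterChain_zero] at hlim
  exact ⟨_, hF.dc_eq θ le_rfl, hlim.of_le s hA hAP, hRP.trans (hlim.isUniversalOver s).1⟩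

theorem card_omega_one_le : (Cardinal.aleph 1).ord.card ≤ μ := by
  rw [card_ord, ← succ_aleph0]
  exact Order.succ_le_of_lt s.aleph0_lt

theorem exists_spreadOut_chain (hU : HasUniversalExtensions K 𝕄 μ) (A : Model K 𝕄)
    (R : Set 𝕄.carrier) (hA : A.dc = μ) (hR : densChar R ≤ μ) :
    ∃ F : Ordinal.{u} → Model K 𝕄, IsContChain μ F μ.ord ∧ F 0 = A ∧ R ⊆ (F μ.ord).set ∧
      ∀ α < μ.ord, IsLimitModel μ (Cardinal.aleph 1).ord (F α) (F (α + 1)) := by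
  have : Nonempty (Model K 𝕄) := ⟨A⟩
  choose! step h1 h2 h3 using fun A hA => s.exists_limitModel hU
    (isSuccLimit_ord (aleph0_le_aleph 1)) s.card_omega_one_le A R hA hR
  have hF := iterChain_isContChain s.aleph0_lt
    (fun A hA => ⟨h1 A hA, ((h2 A hA).isUniversalOver s).1⟩) hA (card_ord μ).le
  have h0 : (0 : Ordinal.{u}) < μ.ord := (isSuccLimit_ord s.aleph0_lt.le).bot_lt
  have h01 : (0 + 1 : Ordinal.{u}) < μ.ord := (isSuccLimit_ord s.aleph0_lt.le).succ_lt h0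
  refine ⟨_, hF, iterChain_zero _ _, ?_, fun α hα => ?_⟩
  · refine Subset.trans ?_ (hF.mono (0 + 1) _ h01.le le_rfl)
    rw [iterChain_add_one]
    exact h3 _ (hF.dc_eq 0 h0.le)
  · rw [iterChain_add_one]
    exact h2 _ (hF.dc_eq α hα.le)

/-- A resolution can be prolonged by `μ` spread-out steps. -/
theorem exists_prolongation (hU : HasUniversalExtensions K 𝕄 μ) {r : ModelSeq K 𝕄}
    {N M : Model K 𝕄} (hr : r.WitnessesLimit μ N M) (hsp : r.SpreadOut μ)
    (hlen : r.length < (Order.succ μ).ord) (hM : M.dc = μ) {R : Set 𝕄.carrier}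
    (hR : densChar R ≤ μ) :
    ∃ (M' : Model K 𝕄) (r' : ModelSeq K 𝕄), M'.dc = μ ∧ r'.WitnessesLimit μ N M' ∧
      r'.SpreadOut μ ∧ r'.length < (Order.succ μ).ord ∧ r.IsExtendedBy r' ∧
      IsLimitModel μ μ.ord M M' ∧ R ⊆ M'.set := by
  classical
  obtain ⟨F, hF, rfl, hRF, hstep⟩ := s.exists_spreadOut_chain hU M R hM hR
  have hμlim : Order.IsSuccLimit μ.ord := isSuccLimit_ord s.aleph0_lt.le
  set σ := r.length with hσ
  -- The chain `F`, which begins with `F 0 = M`, is appended after `r`. As σ is a limit, no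
  -- successor step crosses the junction.
  let r' : ModelSeq K 𝕄 :=
    ⟨σ + μ.ord, fun γ => if h : γ.1 < σ then r.seq ⟨γ.1, h⟩ else F (γ.1 - σ)⟩
  have hlow : ∀ (γ : Iio r'.length) (h : γ.1 < σ), r'.seq γ = r.seq ⟨γ.1, h⟩ :=
    fun γ h => dif_pos h
  have hhigh : ∀ (γ : Iio r'.length) (δ : Ordinal.{u}), γ.1 = σ + δ → r'.seq γ = F δ :=
    fun γ δ h => by
      refine (dif_neg (by rw [h]; simp)).trans ?_
      rw [h, Ordinal.add_sub_cancel]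
  have hcases : ∀ γ : Iio r'.length, γ.1 < σ ∨ ∃ δ < μ.ord, γ.1 = σ + δ := fun γ => by
    rcases lt_or_ge γ.1 σ with h | h
    · exact Or.inl h
    · exact Or.inr ⟨γ.1 - σ, (Ordinal.sub_lt_of_le h).2 γ.2,
        (Ordinal.add_sub_cancel_of_le h).symm⟩
  have hmono : ∀ β γ, β ≤ γ → r'.seq β ≤ r'.seq γ := fun β γ hβγ => by
    have hβγ' : β.1 ≤ γ.1 := hβγ
    rcases hcases γ with hγ | ⟨δ, hδ, hγ⟩
    · rw [hlow γ hγ, hlow β (hβγ'.trans_lt hγ)]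
      exact hr.resolution.mono _ _ hβγ
    · rw [hhigh γ δ hγ]
      rcases hcases β with hβ | ⟨ε, hε, hβ⟩
      · rw [hlow β hβ]
        exact Model.le_trans (hr.resolution.le _) (hF.mono 0 δ zero_le hδ.le)
      · rw [hhigh β ε hβ]
        exact hF.mono ε δ (by rwa [hβ, hγ, add_le_add_iff_left] at hβγ') hδ.le
  have hle : ∀ γ, r'.seq γ ≤ F μ.ord := fun γ => by
    rcases hcases γ with hγ | ⟨δ, hδ, hγ⟩
    · rw [hlow γ hγ]
      exact Model.le_trans (hr.resolution.le _) (hF.mono 0 _ zero_le le_rfl)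
    · rw [hhigh γ δ hγ]
      exact hF.mono _ _ hδ.le le_rfl
  have hdc : ∀ γ, (r'.seq γ).dc = μ := fun γ => by
    rcases hcases γ with hγ | ⟨δ, hδ, hγ⟩
    · rw [hlow γ hγ, hr.resolution.dc_eq]
    · rw [hhigh γ δ hγ, hF.dc_eq δ hδ.le]
  have hspread : r'.SpreadOut μ := fun γ δ hδ => by
    rcases hcases γ with hγ | ⟨ε, hε, hγ⟩
    · have hδσ : δ.1 < σ := by rw [hδ]; exact hr.isLimit.succ_lt hγ
      rw [hlow γ hγ, hlow δ hδσ]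
      exact hsp _ _ hδ
    · rw [hhigh γ ε hγ, hhigh δ (ε + 1) (by rw [hδ, hγ, add_assoc])]
      exact hstep ε hε
  refine ⟨F μ.ord, r', hF.dc_eq _ le_rfl,
    ⟨ModelSeq.isResolution_of_subset hmono ?_ hle ?_ hdc, Ordinal.isSuccLimit_add _ hμlim, ?_, ?_⟩,
    hspread, ?_, ⟨le_self_add, ?_⟩,
    hF.isLimitModel hμlim fun α hα => (hstep α hα).isUniversalOver s, hRF⟩
  · intro γ hγ
    rcases hcases γ with h | ⟨δ, hδ, h⟩
    · rw [hlow γ h, hr.resolution.cont _ hγ]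
      refine closure_mono (iUnion_subset fun β => ?_)
      have hβ : β.1.1 < γ.1 := β.2
      refine subset_iUnion_of_subset ⟨⟨β.1.1, hβ.trans γ.2⟩, hβ⟩ ?_
      rw [hlow _ β.1.2]
    · rw [hhigh γ δ h]
      -- At the junction the term is `M`, and continuity there says that `r` resolves `M`.
      rcases eq_or_ne δ 0 with rfl | hδ0
      · rw [hr.resolution.union]
        refine closure_mono (iUnion_subset fun β => ?_)
        have hβ : β.1 < γ.1 := by rw [h, add_zero]; exact β.2
        refine subset_iUnion_of_subset ⟨⟨β.1, hβ.trans γ.2⟩, hβ⟩ ?_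
        rw [hlow _ β.2]
      · have hlim : Order.IsSuccLimit δ := by
          rw [h, Ordinal.isSuccLimit_add_iff] at hγ
          rcases hγ with h | h
          · exact h
          · exact absurd h.1 hδ0
        rw [hF.cont δ hδ.le hlim]
        refine closure_mono (iUnion_subset fun β => ?_)
        have hβ : σ + β.1 < γ.1 := by rw [h]; exact (add_lt_add_iff_left σ).2 β.2
        refine subset_iUnion_of_subset ⟨⟨σ + β.1, hβ.trans γ.2⟩, hβ⟩ ?_
        rw [hhigh _ β.1 rfl]
  · rw [hF.cont _ le_rfl hμlim]
    refine closure_mono (iUnion_subset fun β => ?_)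
    refine subset_iUnion_of_subset ⟨σ + β.1, (add_lt_add_iff_left σ).2 β.2⟩ ?_
    rw [hhigh _ β.1 rfl]
  · intro γ hγ
    have h0 : γ.1 < σ := by rw [hγ]; exact hr.isLimit.bot_lt
    rw [hlow γ h0]
    exact hr.zero _ hγ
  · exact fun γ δ hδ => (hspread γ δ hδ).isUniversalOver s
  -- Both lengths are below μ⁺, which is closed under ordinal addition.
  · refine Ordinal.isPrincipal_add_ord (s.aleph0_lt.le.trans (Order.le_succ μ)) hlen ?_
    exact ord_lt_ord.2 (Order.lt_succ μ)
  · intro γ δ hδ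
    rw [hlow δ (by rw [hδ]; exact γ.2)]
    exact congrArg r.seq (Subtype.ext hδ)

end Setting

end LimitModels

/-! ### Galois types and smooth independence -/

section Types

variable {K : MAEC.{u} L} {𝕄 : MetricStr.{u} L} {μ : Cardinal.{u}}

theorem mem_gatp_self (a : 𝕄.carrier) (A : Model K 𝕄) : a ∈ gatp a A :=
  ⟨StrIso.refl 𝕄, fun _ _ => rfl, rfl⟩

theorem mem_gatp_symm {a b : 𝕄.carrier} {A : Model K 𝕄} (h : b ∈ gatp a A) : a ∈ gatp b A := by
  obtain ⟨g, hg, rfl⟩ := h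
  exact ⟨g.symm, fun x hx => g.symm_apply_eq.2 (hg x hx).symm, g.symm_apply_apply a⟩

theorem mem_gatp_trans {a b c : 𝕄.carrier} {A : Model K 𝕄} (h : b ∈ gatp a A)
    (h' : c ∈ gatp b A) : c ∈ gatp a A := by
  obtain ⟨g, hg, rfl⟩ := h
  obtain ⟨f, hf, rfl⟩ := h'
  exact ⟨g.trans f, fun x hx => by rw [StrIso.trans_apply, hg x hx, hf x hx], rfl⟩

theorem gatp_eq_of_mem {a b : 𝕄.carrier} {A : Model K 𝕄} (h : b ∈ gatp a A) :
    gatp b A = gatp a A :=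
  Subset.antisymm (fun _ hc => mem_gatp_trans h hc) fun _ hc =>
    mem_gatp_trans (mem_gatp_symm h) hc

theorem image_gatp (g : StrIso 𝕄 𝕄) (a : 𝕄.carrier) (A : Model K 𝕄) :
    g '' gatp a A = gatp (g a) (A.map g) := by
  ext b
  constructor
  · rintro ⟨_, ⟨f, hf, rfl⟩, rfl⟩
    refine ⟨(g.symm.trans f).trans g, ?_, ?_⟩
    · rintro _ ⟨x, hx, rfl⟩
      rw [StrIso.trans_apply, StrIso.trans_apply, StrIso.symm_apply_apply, hf x hx]
    · rw [StrIso.trans_apply, StrIso.trans_apply, StrIso.symm_apply_apply]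
  · rintro ⟨f, hf, rfl⟩
    refine ⟨g.symm (f (g a)), ⟨(g.trans f).trans g.symm, fun x hx => ?_, rfl⟩,
      g.apply_symm_apply _⟩
    rw [StrIso.trans_apply, StrIso.trans_apply, hf _ (mem_image_of_mem g hx),
      StrIso.symm_apply_apply]

theorem typeDist_image (g : StrIso 𝕄 𝕄) (p q : Set 𝕄.carrier) :
    typeDist (g '' p) (g '' q) = typeDist p q := by
  unfold typeDist
  congr 1
  ext r
  simp only [exists_mem_image]
  refine exists_congr fun a => and_congr_right fun _ => exists_congr fun b =>
    and_congr_right fun _ => ?_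
  rw [g.dist_apply]

/-- Types at distance zero are equal. -/
theorem ContinuityOfTypes.gatp_eq (hCTP : ContinuityOfTypes K 𝕄) {A : Model K 𝕄}
    (hA : A.dc < 𝕄.dc) {a b : 𝕄.carrier}
    (h : ∀ ε : ℝ, 0 < ε → typeDist (gatp a A) (gatp b A) < ε) : gatp a A = gatp b A := by
  have key : ∀ n : ℕ, ∃ c ∈ gatp a A, dist c b < 1 / ((n : ℝ) + 1) := fun n => by
    have hne : {r : ℝ | ∃ c ∈ gatp a A, ∃ d ∈ gatp b A, r = dist c d}.Nonempty :=
      ⟨_, a, mem_gatp_self a A, b, mem_gatp_self b A, rfl⟩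
    obtain ⟨r, ⟨c, hc, d, ⟨g, hg, rfl⟩, rfl⟩, hr⟩ :=
      exists_lt_of_csInf_lt hne (h _ (Nat.one_div_pos_of_nat (n := n)))
    -- Moving the close pair back by `g` makes its second member `b` itself, so realizations of the
    -- first type converge to `b`.
    refine ⟨g.symm c, mem_gatp_trans hc
      ⟨g.symm, fun x hx => g.symm_apply_eq.2 (hg x hx).symm, rfl⟩, ?_⟩
    rw [← g.dist_apply, StrIso.apply_symm_apply]
    exact hr
  choose c hc hcb using key
  have hlim : Filter.Tendsto c Filter.atTop (nhds b) := by
    rw [tendsto_iff_dist_tendsto_zero]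
    exact squeeze_zero (fun _ => dist_nonneg) (fun n => (hcb n).le)
      tendsto_one_div_add_atTop_nhds_zero_nat
  have heq : ∀ n, gatp (c n) A = gatp a A := fun n => gatp_eq_of_mem (hc n)
  rw [hCTP A hA c b hlim fun n => (heq n).trans (heq 0).symm, heq 0]

theorem Splits.mono {ε : ℝ} {a : 𝕄.carrier} {A M M' : Model K 𝕄} (h : Splits ε a A M)
    (hM : M ≤ M') : Splits ε a A M' := by
  obtain ⟨N₁, N₂, h1, h2, h3, h4, h5⟩ := h
  exact ⟨N₁, N₂, h1, Model.le_trans h2 hM, h3, Model.le_trans h4 hM, h5⟩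

theorem Splits.map {ε : ℝ} {a : 𝕄.carrier} {A M : Model K 𝕄} (h : Splits ε a A M)
    (g : StrIso 𝕄 𝕄) : Splits ε (g a) (A.map g) (M.map g) := by
  obtain ⟨N₁, N₂, h1, h2, h3, h4, f, hf, hfN, hd⟩ := h
  refine ⟨N₁.map g, N₂.map g, Model.map_mono h1, Model.map_mono h2, Model.map_mono h3,
    Model.map_mono h4, (g.symm.trans f).trans g, ?_, ?_, ?_⟩
  · rintro _ ⟨x, hx, rfl⟩
    rw [StrIso.trans_apply, StrIso.trans_apply, StrIso.symm_apply_apply, hf x hx]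
  · rw [← Model.map_set, ← Model.map_trans]
    have h : N₁.map f = N₂ := Model.eq_of_set_eq hfN
    rw [← h, ← Model.map_trans]
    refine congrArg Model.set (Model.map_congr fun x _ => ?_)
    simp only [StrIso.trans_apply, StrIso.symm_apply_apply]
  · rw [StrIso.trans_apply, StrIso.trans_apply, StrIso.symm_apply_apply, ← image_gatp,
      ← image_gatp, typeDist_image]
    exact hd

theorem SmoothIndep.mono {r : ModelSeq K 𝕄} {a : 𝕄.carrier} {M M' : Model K 𝕄}
    (h : SmoothIndep r a M') (hM : M ≤ M') : SmoothIndep r a M := fun ε hε => by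
  obtain ⟨γ, hγ⟩ := h ε hε
  exact ⟨γ, fun h' => hγ (h'.mono hM)⟩

/-- Splitting is invariant under automorphisms, and `g` leaves every base `r.seq γ` in place. -/
theorem SmoothIndep.map_of_fixes {r : ModelSeq K 𝕄} {a : 𝕄.carrier} {M : Model K 𝕄}
    (h : SmoothIndep r a M) {g : StrIso 𝕄 𝕄} (hg : ∀ γ, ∀ x ∈ (r.seq γ).set, g x = x) :
    SmoothIndep r (g a) (M.map g) := fun ε hε => by
  obtain ⟨γ, hγ⟩ := h ε hε
  refine ⟨γ, fun h' => hγ ?_⟩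
  have h2 := h'.map g.symm
  rwa [StrIso.symm_apply_apply, Model.map_symm_map,
    Model.map_eq_self fun x hx => g.symm_apply_eq.2 (hg γ x hx).symm] at h2

/-- Extension property of smooth independence. -/
theorem SmoothIndep.exists_extension (s : Setting K 𝕄 μ) (hCTP : ContinuityOfTypes K 𝕄)
    {r : ModelSeq K 𝕄} {a : 𝕄.carrier} {N M M' : Model K 𝕄} (h : SmoothIndep r a M)
    (hr : ∀ γ, r.seq γ ≤ N) (hN : N.dc = μ) (hM : M.dc = μ) (hNM : IsUniversalOver μ N M)
    (hM' : M'.dc = μ) (hMM' : M ≤ M') :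
    ∃ g : StrIso 𝕄 𝕄, (∀ x ∈ M.set, g x = x) ∧ SmoothIndep r a (M'.map g) ∧
      (a ∈ (M'.map g).set → a ∈ M.set) := by
  -- `M'` is pulled into `M` over `N`, where independence of `a` is already known.
  obtain ⟨f, hf, hfM⟩ := ((s.isUniversalOver_iff hN).1 hNM).2 M'
    (Model.le_trans hNM.1 hMM') hM'
  have hf' : ∀ x ∈ N.set, f.symm x = x := fun x hx => f.symm_apply_eq.2 (hf x hx).symm
  have hind : SmoothIndep r (f.symm a) M' := by
    have h1 := (h.mono hfM).map_of_fixes (g := f.symm) fun γ x hx => hf' x (hr γ hx)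
    rwa [Model.map_symm_map] at h1
  have htp : gatp a (M.map f) = gatp (f a) (M.map f) := by
    refine hCTP.gatp_eq ((M.dc_map f).trans hM ▸ s.lt_dc) fun ε hε => ?_
    obtain ⟨γ, hγ⟩ := h ε hε
    by_contra hlt
    -- A distance of at least ε would make `M` and its image under `f` witnesses of ε-splitting over
    -- `r.seq γ`.
    exact hγ ⟨M, M.map f, Model.le_trans (hr γ) hNM.1, M.le_refl,
      Model.le_trans (hr γ) (Model.le_map_of_fixes hf hNM.1),
      Model.le_trans (Model.map_mono hMM') hfM, f, fun x hx => hf x (hr γ hx), rfl, not_lt.1 hlt⟩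
  have htp' : gatp (f.symm a) M = gatp a M := by
    have h1 := congrArg (fun p => f.symm '' p) htp
    simp only [image_gatp, Model.map_symm_map, StrIso.symm_apply_apply] at h1
    exact h1
  obtain ⟨φ, hφ, hφa⟩ : a ∈ gatp (f.symm a) M := htp' ▸ mem_gatp_self a M
  refine ⟨φ, hφ, ?_, fun ha => ?_⟩
  · have h1 := hind.map_of_fixes (g := φ) fun γ x hx => hφ x (hNM.1 (hr γ hx))
    rwa [hφa] at h1
  -- If `a` lies in the image of `M'` under φ, then `f.symm a` lies in `M'`, so `a` lies in the
  -- image of `M'` under `f`, which is inside `M`.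
  · rw [Model.mem_map_iff, φ.symm_apply_eq.2 hφa.symm] at ha
    have h1 : f (f.symm a) ∈ (M'.map f).set := Model.apply_mem_map.2 ha
    rw [StrIso.apply_symm_apply] at h1
    exact hfM h1

end Types

/-! ### Direct limits inside the monster model -/

section Limits

variable {K : MAEC.{u} L} {𝕄 : MetricStr.{u} L} {μ : Cardinal.{u}}

/-- A finite tuple from an increasing union lies in one member. Identities for functions and
relations can thus be checked in a single member of a chain and extended by continuity. -/
theorem dense_setOf_forall_mem {X ι : Type u} [TopologicalSpace X] [LinearOrder ι] [Nonempty ι]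
    {B : ι → Set X} (hB : Monotone B) (hd : Dense (⋃ i, B i)) (n : ℕ) :
    Dense {x : Fin n → X | ∃ i, ∀ k, x k ∈ B i} := by
  refine (dense_pi Set.univ fun (_ : Fin n) _ => hd).mono fun x hx => ?_
  have h : ∀ k, ∃ i, x k ∈ B i := fun k => mem_iUnion.1 (hx k trivial)
  choose i hi using h
  obtain ⟨j, hj⟩ := Finite.exists_le i
  exact ⟨j, fun k => hB (hj k) (hi k)⟩

theorem exists_isometry_extension {X Y : Type u} [MetricSpace X] [MetricSpace Y] [CompleteSpace Y]
    {D : Set X} (hD : Dense D) {f : X → Y}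
    (hf : ∀ x ∈ D, ∀ y ∈ D, dist (f x) (f y) = dist x y) :
    ∃ e : X → Y, Isometry e ∧ ∀ x ∈ D, e x = f x := by
  have hiso : Isometry (fun x : D => f x) := Isometry.of_dist_eq fun x y => hf x x.2 y y.2
  have hext : ∀ x ∈ D, hD.extend (fun x : D => f x) x = f x := fun x hx =>
    hD.extend_of_ind hiso.uniformContinuous ⟨x, hx⟩
  refine ⟨_, Isometry.of_dist_eq fun x y => ?_, hext⟩
  have hc := (hD.uniformContinuous_extend hiso.uniformContinuous).continuous
  have h : (fun p : X × X => dist (hD.extend (fun x : D => f x) p.1)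
      (hD.extend (fun x : D => f x) p.2)) = fun p => dist p.1 p.2 := by
    refine Continuous.ext_on (hD.prod hD) (by fun_prop) (by fun_prop) fun p hp => ?_
    rw [hext _ hp.1, hext _ hp.2, hf _ hp.1 _ hp.2]
  exact congrFun h (x, y)

/-- Automorphisms that agree on an increasing chain of models can be replaced by a single one. -/
theorem IsMonster.exists_glue (h𝕄 : IsMonster K 𝕄) {ι : Type u} [LinearOrder ι]
    [WellFoundedLT ι] [Nonempty ι] {B : ι → Model K 𝕄} (hB : ∀ i j, i ≤ j → B i ≤ B j)
    (hdc : densChar (⋃ i, (B i).set) < 𝕄.dc) {θ : ι → StrIso 𝕄 𝕄}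
    (hθ : ∀ i j, i ≤ j → ∀ x ∈ (B i).set, θ j x = θ i x) :
    ∃ g : StrIso 𝕄 𝕄, ∀ i, ∀ x ∈ (B i).set, g x = θ i x := by
  obtain ⟨C, hC⟩ := Model.exists_chain_union B hB
  -- The completed union of the images is a strong model by the chain axiom; it serves as the target
  -- of the glued isomorphism, to which homogeneity applies.
  obtain ⟨C', hC'⟩ := Model.exists_chain_union (fun i => (B i).map (θ i)) fun i j hij => by
    rw [← Model.map_congr (hθ i j hij)]
    exact Model.map_mono (hB i j hij)
  have hBC : ∀ i, B i ≤ C := fun i => by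
    rw [Model.le_def, hC]
    exact (subset_iUnion (fun i => (B i).set) i).trans subset_closure
  have hBC' : ∀ i, (B i).map (θ i) ≤ C' := fun i => by
    rw [Model.le_def, hC']
    exact (subset_iUnion (fun i => ((B i).map (θ i)).set) i).trans subset_closure
  let D : ι → Set C.toStr.carrier := fun i => {x | x.1 ∈ (B i).set}
  have hDmono : Monotone D := fun i j hij x hx => hB i j hij hx
  have hD : Dense (⋃ i, D i) := fun x => by
    refine closure_subtype.2 (closure_mono ?_ (hC.subset x.2))
    refine iUnion_subset fun i y hy => ⟨⟨y, hBC i hy⟩, mem_iUnion.2 ⟨i, hy⟩, rfl⟩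
  have hθ' : ∀ i j, ∀ x ∈ (B i).set, x ∈ (B j).set → θ i x = θ j x := fun i j x hi hj => by
    rcases le_total i j with h | h
    · exact (hθ i j h x hi).symm
    · exact hθ j i h x hj
  have hex : ∃ f : C.toStr.carrier → 𝕄.carrier, ∀ i, ∀ x ∈ D i, f x = θ i x.1 := by
    classical
    refine ⟨fun x => if h : ∃ i, x ∈ D i then θ h.choose x.1 else x.1, fun i x hx => ?_⟩
    have h : ∃ i, x ∈ D i := ⟨i, hx⟩
    exact (dif_pos h).trans (hθ' _ _ _ h.choose_spec hx)
  obtain ⟨f, hf⟩ := hex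
  obtain ⟨e, he, hef⟩ := exists_isometry_extension hD (f := f) fun x hx y hy => by
    obtain ⟨i, hi⟩ := mem_iUnion.1 hx
    obtain ⟨j, hj⟩ := mem_iUnion.1 hy
    rw [hf _ x (hDmono (le_max_left i j) hi), hf _ y (hDmono (le_max_right i j) hj),
      StrIso.dist_apply]
    rfl
  have heθ : ∀ i, ∀ x ∈ D i, e x = θ i x.1 := fun i x hx =>
    (hef x (mem_iUnion.2 ⟨i, hx⟩)).trans (hf i x hx)
  have hrange : C'.toSub.carrier = range e := by
    refine Subset.antisymm ?_ ?_
    · change C'.set ⊆ _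
      rw [hC']
      refine closure_minimal (iUnion_subset fun i => ?_) he.isClosedEmbedding.isClosed_range
      rintro _ ⟨x, hx, rfl⟩
      exact ⟨⟨x, hBC i hx⟩, heθ i _ hx⟩
    · have h1 : e '' (⋃ i, D i) ⊆ C'.set := by
        rintro _ ⟨x, hx, rfl⟩
        obtain ⟨i, hi⟩ := mem_iUnion.1 hx
        rw [heθ i x hi]
        exact hBC' i ⟨_, hi, rfl⟩
      have h2 := image_closure_subset_closure_image he.continuous (s := ⋃ i, D i)
      rw [hD.closure_eq, image_univ] at h2
      exact h2.trans (closure_minimal h1 C'.isClosed_set)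
  have hc : ∀ n, Continuous fun (x : Fin n → C.toStr.carrier) k => e (x k) :=
    fun n => (StrIso.isometry_pi he).continuous
  have hfn : ∀ {n : ℕ} (F : L.Functions n) (x : Fin n → C.toStr.carrier),
      e (C.toStr.fn F x) = 𝕄.fn F (fun k => e (x k)) := fun {n} F => by
    refine congrFun (Continuous.ext_on (dense_setOf_forall_mem hDmono hD n)
      (he.continuous.comp (C.toStr.continuous_fun F)) ((𝕄.continuous_fun F).comp (hc n)) ?_)
    rintro x ⟨i, hi⟩
    have h1 : C.toStr.fn F x ∈ D i := (B i).toSub.fn_mem F _ hi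
    have h2 := (θ i).apply_fn F fun k => (x k).1
    simp only [← heθ i _ (hi _)] at h2
    exact (heθ i _ h1).trans h2
  have hrel : ∀ {n : ℕ} (R : L.Relations n) (x : Fin n → C.toStr.carrier),
      Metric.infEDist x (C.toStr.rel R) = Metric.infEDist (fun k => e (x k)) (𝕄.rel R) :=
    fun {n} R => by
    refine congrFun (Continuous.ext_on (dense_setOf_forall_mem hDmono hD n)
      Metric.continuous_infEDist (Metric.continuous_infEDist.comp (hc n)) ?_)
    rintro x ⟨i, hi⟩
    have h2 := (θ i).infEDist_rel R fun k => (x k).1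
    simp only [← heθ i _ (hi _)] at h2
    exact (C.toSub.infEDist_rel R x).trans h2
  obtain ⟨g, hg⟩ := h𝕄.homogeneous C C' (by rwa [Model.dc, hC, densChar_closure])
    (StrIso.ofRange e he hfn hrel C'.toSub hrange)
  exact ⟨g, fun i x hx => (hg ⟨x, hBC i hx⟩).trans (heθ i ⟨x, hBC i hx⟩ hx)⟩

/-- Directed systems of automorphisms have limits. -/
theorem Setting.exists_direct_limit (s : Setting K 𝕄 μ) {ι : Type u} [LinearOrder ι]
    [WellFoundedLT ι] (hι : #ι ≤ μ) {Q B : ι → Model K 𝕄}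
    (hQ : ∀ i, (Q i).dc = μ) (hB : ∀ i j, i ≤ j → B i ≤ B j) (hBQ : ∀ i, B i ≤ Q i)
    {f : ι → ι → StrIso 𝕄 𝕄} (hfQ : ∀ i j, i ≤ j → (Q i).map (f i j) ≤ Q j)
    (hf_self : ∀ i, ∀ x ∈ (Q i).set, f i i x = x)
    (hf_comp : ∀ i j k, i ≤ j → j ≤ k → ∀ x ∈ (Q i).set, f j k (f i j x) = f i k x)
    (hfB : ∀ i j, i ≤ j → ∀ x ∈ (B i).set, f i j x = x) :
    ∃ g : ι → StrIso 𝕄 𝕄, (∀ i, ∀ x ∈ (B i).set, g i x = x) ∧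
      ∀ i j, i ≤ j → ∀ x ∈ (Q i).set, g j (f i j x) = g i x := by
  rcases isEmpty_or_nonempty ι with hemp | hne
  · exact ⟨fun _ => StrIso.refl 𝕄, fun i => isEmptyElim i, fun i => isEmptyElim i⟩
  have hmem : ∀ i j, i ≤ j → ∀ x : (Q i).toStr.carrier, f i j x.1 ∈ (Q j).set :=
    fun i j h x => hfQ i j h ⟨x.1, x.2, rfl⟩
  obtain ⟨N, γ, hN, hγ, hγf, hγd⟩ := K.chain_completion (fun i => (Q i).toStr)
    (fun i j h x => ⟨f i j x.1, hmem i j h x⟩)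
    (fun i j h => ((MAEC.isEmb_strIso (f i j) s.monster.mem).comp (Q i).isEmb_val).codRestrict
      (Q j).strong (hmem i j h))
    (fun i x => Subtype.ext (hf_self i x.1 x.2))
    (fun i j k hij hjk x => Subtype.ext (hf_comp i j k hij hjk x.1 x.2))
  have hNdc : N.dc ≤ μ := by
    rw [MetricStr.dc, ← hγd, densChar_closure]
    refine densChar_iUnion_le s.aleph0_lt.le hι fun i => ?_
    rw [densChar_range_of_isometry (hγ i).isometry]
    exact ((Q i).dc_toStr.trans (hQ i)).le
  obtain ⟨u, hu⟩ := s.monster.universal N hN (hNdc.trans_lt s.lt_dc)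
  -- Each canonical map into the limit, followed by `u`, extends to an automorphism.
  choose θ hθ using fun i => s.monster.exists_extension (hQ i ▸ s.lt_dc) (hu.comp (hγ i))
  have hcoh : ∀ i j, i ≤ j → ∀ x ∈ (Q i).set, θ j (f i j x) = θ i x := fun i j hij x hx =>
    (hθ j ⟨f i j x, hmem i j hij ⟨x, hx⟩⟩).trans
      ((congrArg u (hγf i j hij ⟨x, hx⟩)).trans (hθ i ⟨x, hx⟩).symm)
  -- The transition maps fix the `B i`, so the θ's agree along this chain and glue to `G`. Undoing
  -- `G` makes the limit maps fix every `B i`.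
  obtain ⟨G, hG⟩ := s.monster.exists_glue hB
    ((densChar_iUnion_le s.aleph0_lt.le hι fun i =>
      Model.dc_le_of_le s.aleph0_lt.le (hBQ i) (hQ i).le).trans_lt s.lt_dc)
    (θ := θ) fun i j hij x hx => by
      rw [← hcoh i j hij x (hBQ i hx), hfB i j hij x hx]
  refine ⟨fun i => (θ i).trans G.symm, fun i x hx => ?_, fun i j hij x hx => ?_⟩
  · rw [StrIso.trans_apply, ← hG i x hx, StrIso.symm_apply_apply]
  · rw [StrIso.trans_apply, hcoh i j hij x hx, StrIso.trans_apply]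

end Limits

/-! ### The construction of the extended tower -/

/-- Construction by well-founded recursion of a function whose value at `i` is related to its
values below `i`. -/
theorem exists_forall_of_wellFoundedLT {I D : Type*} [LinearOrder I] [WellFoundedLT I] [Nonempty D]
    (P : I → (I → D) → D → Prop)
    (hcongr : ∀ i F G d, (∀ j < i, F j = G j) → P i F d → P i G d)
    (hstep : ∀ i F, (∀ j < i, P j F (F j)) → ∃ d, P i F d) : ∃ F : I → D, ∀ i, P i F (F i) := by
  classical
  obtain ⟨d₀⟩ := ‹Nonempty D›
  have hwf : WellFounded (fun a b : I => a < b) := wellFounded_lt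
  let F : I → D := hwf.fix fun i ih =>
    -- Values not yet constructed are replaced by `d₀`; `hcongr` makes them irrelevant.
    @Classical.epsilon D ⟨d₀⟩ (P i fun j => if h : j < i then ih j h else d₀)
  have hF : ∀ i, F i = @Classical.epsilon D ⟨d₀⟩ (P i fun j => if j < i then F j else d₀) :=
    fun i => hwf.fix_eq _ i
  refine ⟨F, fun i => ?_⟩
  induction i using hwf.induction with
  | _ i ih =>
    have hH : ∀ j < i, (if j < i then F j else d₀) = F j := fun j hj => if_pos hj
    have h1 := Classical.epsilon_spec (hstep i (fun j => if j < i then F j else d₀) fun j hj =>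
      hcongr j F _ _ (fun k hk => (hH k (hk.trans hj)).symm) ((hH j hj).symm ▸ ih j hj))
    rw [← hF i] at h1
    exact hcongr i _ F _ hH h1

section Construction

variable {K : MAEC.{u} L} {𝕄 : MetricStr.{u} L} {μ : Cardinal.{u}}

/-- The data chosen at one stage of the construction: a model with a resolution, a larger model,
and the transition maps from the earlier stages. -/
structure Stage (K : MAEC.{u} L) (𝕄 : MetricStr.{u} L) (I : Type u) where
  M : Model K 𝕄
  res : ModelSeq K 𝕄
  Q : Model K 𝕄
  f : I → StrIso 𝕄 𝕄

variable {I : Type u} [LinearOrder I]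

/-- The requirements on stage `i`, relative to the earlier stages `F`; `nx` is the successor
function of `I`. -/
structure Stage.IsGood (μ : Cardinal.{u}) (T : Tower K 𝕄 I) (nx : I → I) (i : I)
    (F : I → Stage K 𝕄 I) (d : Stage K 𝕄 I) : Prop where
  dc_M : d.M.dc = μ
  witness : d.res.WitnessesLimit μ (T.N i) d.M
  spreadOut : d.res.SpreadOut μ
  length_lt : d.res.length < (Order.succ μ).ord
  extends_res : (T.resM i).IsExtendedBy d.res
  isLimitModel : IsLimitModel μ μ.ord (T.M i) d.M
  indep : SmoothIndep (T.resN i) (T.a i) d.M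
  notMem : T.a i ∉ d.M.set
  dc_Q : d.Q.dc = μ
  M_le_Q : d.M ≤ d.Q
  succ_le_Q : T.M (nx i) ≤ d.Q
  map_le : ∀ j < i, (F j).Q.map (d.f j) ≤ d.M
  fixes : ∀ j < i, ∀ x ∈ (T.M (nx j)).set, d.f j x = x
  comp : ∀ j < i, ∀ k < j, ∀ x ∈ (F k).Q.set, d.f j ((F j).f k x) = d.f k x

theorem Stage.IsGood.congr {T : Tower K 𝕄 I} {nx : I → I} {i : I} {F G : I → Stage K 𝕄 I}
    {d : Stage K 𝕄 I} (h : d.IsGood μ T nx i F) (hFG : ∀ j < i, F j = G j) :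
    d.IsGood μ T nx i G :=
  { h with
    map_le := fun j hj => hFG j hj ▸ h.map_le j hj
    comp := fun j hj k hk => by
      rw [← hFG j hj, ← hFG k (hk.trans hj)]
      exact h.comp j hj k hk }

/-- Used twice: for the stages below `i` when stage `i` is built, and for all stages at the end. -/
theorem exists_limit_of_stages [WellFoundedLT I] (s : Setting K 𝕄 μ) (hI : #I ≤ μ)
    {T : Tower K 𝕄 I} (hT : T.IsMetricSTower μ) {nx : I → I} (hnx : ∀ i, i ⋖ nx i)
    {F : I → Stage K 𝕄 I} (p : I → Prop)
    (hF : ∀ i, p i → (F i).IsGood μ T nx i F) :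
    ∃ g : I → StrIso 𝕄 𝕄, (∀ i, p i → ∀ x ∈ (T.M (nx i)).set, g i x = x) ∧
      ∀ i j, p i → p j → i < j → ∀ x ∈ (F i).Q.set, g j ((F j).f i x) = g i x := by
  classical
  -- The diagonal is set to the identity because `(F i).f i` is unconstrained.
  let f : {i // p i} → {i // p i} → StrIso 𝕄 𝕄 := fun i j =>
    if i = j then StrIso.refl 𝕄 else (F j.1).f i.1
  have hf_self : ∀ i, f i i = StrIso.refl 𝕄 := fun i => if_pos rfl
  have hf_lt : ∀ i j, i < j → f i j = (F j.1).f i.1 := fun i j h => if_neg h.ne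
  obtain ⟨g, hg1, hg2⟩ := s.exists_direct_limit (ι := {i // p i})
    ((mk_subtype_le p).trans hI) (Q := fun i => (F i.1).Q) (B := fun i => T.M (nx i.1))
    (fun i => (hF i.1 i.2).dc_Q)
    (fun i j hij => by
      rcases hij.eq_or_lt with rfl | h
      · exact Model.le_refl _
      · exact hT.mono _ _ (((hnx i.1).ge_of_gt h).trans (hnx j.1).le))
    (fun i => (hF i.1 i.2).succ_le_Q) (f := f)
    (fun i j hij => by
      rcases hij.eq_or_lt with rfl | h
      · rw [hf_self, Model.map_refl]
        exact Model.le_refl _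
      · rw [hf_lt i j h]
        exact Model.le_trans ((hF j.1 j.2).map_le i.1 h) (hF j.1 j.2).M_le_Q)
    (fun i x _ => by rw [hf_self, StrIso.refl_apply])
    (fun i j k hij hjk x hx => by
      rcases hij.eq_or_lt with rfl | h
      · rw [hf_self, StrIso.refl_apply]
      rcases hjk.eq_or_lt with rfl | h'
      · rw [hf_self, StrIso.refl_apply]
      rw [hf_lt i j h, hf_lt j k h', hf_lt i k (h.trans h')]
      exact (hF k.1 k.2).comp j.1 h' i.1 h x hx)
    (fun i j hij x hx => by
      rcases hij.eq_or_lt with rfl | h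
      · rw [hf_self, StrIso.refl_apply]
      · rw [hf_lt i j h]
        exact (hF j.1 j.2).fixes i.1 h x hx)
  refine ⟨fun i => if h : p i then g ⟨i, h⟩ else StrIso.refl 𝕄, fun i hi => ?_,
    fun i j hi hj hij x hx => ?_⟩
  · simp only [dif_pos hi]
    exact hg1 ⟨i, hi⟩
  · simp only [dif_pos hi, dif_pos hj]
    rw [← hf_lt ⟨i, hi⟩ ⟨j, hj⟩ hij]
    exact hg2 ⟨i, hi⟩ ⟨j, hj⟩ (le_of_lt hij) x hx

/-- The prolongation `M'` absorbs the limit of the earlier stages, and φ then moves `M'` to a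
position independent from `T.a i`. Since φ fixes `T.M i`, it fixes the old resolution and every `T.M
(nx j)` with `j < i`, so the transition maps can be composed with it. -/
theorem exists_stage [WellFoundedLT I] (s : Setting K 𝕄 μ) (hCTP : ContinuityOfTypes K 𝕄)
    (hI : #I ≤ μ) {T : Tower K 𝕄 I} (hT : T.IsMetricSTower μ) {nx : I → I}
    (hnx : ∀ i, i ⋖ nx i) (i : I) {F : I → Stage K 𝕄 I}
    (hF : ∀ j < i, (F j).IsGood μ T nx j F) :
    ∃ d : Stage K 𝕄 I, d.IsGood μ T nx i F := by
  obtain ⟨g, hg1, hg2⟩ := exists_limit_of_stages s hI hT hnx (· < i) hF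
  have hdens : densChar (⋃ j : Iio i, ((F j.1).Q.map (g j.1)).set) ≤ μ :=
    densChar_iUnion_le s.aleph0_lt.le ((mk_subtype_le (· ∈ Iio i)).trans hI) fun j =>
      ((Model.dc_map _ _).trans (hF j.1 j.2).dc_Q).le
  obtain ⟨M', r', hM', hwit, hsp, hlen, hext, hlim, hR⟩ :=
    s.exists_prolongation ((hT.witness i).hasUniversalExtensions s) (hT.witness i)
      (hT.spreadOut i) (hT.length_lt i) (hT.dcM i) hdens
  have hNM := (hT.witness i).isUniversalOver s
  have hMM' : T.M i ≤ M' := (hlim.isUniversalOver s).1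
  obtain ⟨φ, hφ, hind, hmem⟩ := (hT.indep i).exists_extension s hCTP (hT.resN i).le (hT.dcN i)
    (hT.dcM i) hNM.2 hM' hMM'
  obtain ⟨Q, hQ, hMQ, hsQ⟩ := s.exists_model_ge ((M'.dc_map φ).trans hM')
    (R := (T.M (nx i)).set) (hT.dcM (nx i)).le
  have hMφ : (T.M i).map φ = T.M i := Model.map_eq_self hφ
  have hNφ : (T.N i).map φ = T.N i := Model.map_eq_self fun x hx => hφ x (hNM.2.1 hx)
  have hwit' := hwit.map s φ
  have hlim' := hlim.map s φ
  rw [hNφ] at hwit'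
  rw [hMφ] at hlim'
  refine ⟨⟨M'.map φ, r'.map φ, Q, fun j => (g j).trans φ⟩, (M'.dc_map φ).trans hM', hwit',
    hsp.map s φ, hlen, ⟨hext.1, fun γ δ hδ => ?_⟩, hlim', hind,
    fun h => (hT.elem i (nx i) (hnx i)).2 (hmem h), hQ, hMQ, hsQ, fun j hj => ?_,
    fun j hj x hx => ?_, fun j hj k hk x hx => ?_⟩
  · change (r'.seq δ).map φ = _
    rw [hext.2 γ δ hδ]
    exact Model.map_eq_self fun x hx => hφ x ((hT.resM i).le γ hx)
  · rw [Model.map_trans]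
    exact Model.map_mono
      ((subset_iUnion (fun j : Iio i => ((F j.1).Q.map (g j.1)).set) ⟨j, hj⟩).trans hR)
  · rw [StrIso.trans_apply, hg1 j hj x hx]
    exact hφ x (hT.mono _ _ ((hnx j).ge_of_gt hj) hx)
  · rw [StrIso.trans_apply, StrIso.trans_apply, hg2 k j (hk.trans hj) hj hk x hx]

theorem exists_extended_tower [WellFoundedLT I] [NoMaxOrder I] (s : Setting K 𝕄 μ)
    (hCTP : ContinuityOfTypes K 𝕄) (hI : #I ≤ μ) {T : Tower K 𝕄 I} (hT : T.IsMetricSTower μ) :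
    ∃ T' : Tower K 𝕄 I, T'.IsMetricSTower μ ∧ T.IsExtendedBy T' ∧
      ∀ i, IsLimitModel μ μ.ord (T.M i) (T'.M i) := by
  -- Without a last element, the least element above `i` is its successor.
  have hcov : ∀ i : I, ∃ j, i ⋖ j := fun i => by
    obtain ⟨j, hj, hmin⟩ := wellFounded_lt.has_min (Ioi i) (exists_gt i)
    exact ⟨j, hj, fun k hik hkj => hmin k hik hkj⟩
  choose nx hnx using hcov
  rcases isEmpty_or_nonempty I with hemp | ⟨⟨i₀⟩⟩
  · exact ⟨T, hT, by constructor <;> exact fun i => isEmptyElim i, fun i => isEmptyElim i⟩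
  have : Nonempty (Stage K 𝕄 I) := ⟨⟨T.M i₀, T.resM i₀, T.M i₀, fun _ => StrIso.refl 𝕄⟩⟩
  obtain ⟨F, hF⟩ := exists_forall_of_wellFoundedLT
    (fun i F d => Stage.IsGood (K := K) (𝕄 := 𝕄) μ T nx i F d)
    (fun i F G d hFG h => h.congr hFG) fun i F hF => exists_stage s hCTP hI hT hnx i hF
  obtain ⟨g, hg1, hg2⟩ := exists_limit_of_stages s hI hT hnx (fun _ => True) fun i _ => hF i
  have hgM : ∀ i, ∀ x ∈ (T.M i).set, g i x = x := fun i x hx =>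
    hg1 i trivial x (hT.mono _ _ (hnx i).le hx)
  -- This is why the transition maps are required to fix `T.M (nx i)` and not just `T.M i`.
  have hga : ∀ i, g i (T.a i) = T.a i := fun i =>
    hg1 i trivial _ (hT.elem i (nx i) (hnx i)).1
  have hNM : ∀ i, T.N i ≤ T.M i := fun i => ((hT.witness i).isUniversalOver s).2.1
  have hgN : ∀ i, (T.N i).map (g i) = T.N i := fun i =>
    Model.map_eq_self fun x hx => hgM i x (hNM i hx)
  have hlim : ∀ i, IsLimitModel μ μ.ord (T.M i) ((F i).M.map (g i)) := fun i => by
    have h := (hF i).isLimitModel.map s (g i)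
    rwa [Model.map_eq_self (hgM i)] at h
  have hwit : ∀ i, ((F i).res.map (g i)).WitnessesLimit μ (T.N i) ((F i).M.map (g i)) :=
    fun i => by
    have h := (hF i).witness.map s (g i)
    rwa [hgN i] at h
  have hdc : ∀ i, ((F i).M.map (g i)).dc = μ := fun i => (Model.dc_map _ _).trans (hF i).dc_M
  refine ⟨⟨fun i => (F i).M.map (g i), T.a, T.N, fun i => (F i).res.map (g i), T.resN⟩,
    { mono := fun i j hij => ?_
      dcM := hdc
      dcN := hT.dcN
      resM := fun i => (hwit i).resolution
      resN := hT.resN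
      limit := fun i => ⟨_, (hF i).length_lt, (F i).res.map (g i), rfl, hwit i⟩
      elem := fun i j hij => ⟨(hlim j).isUniversalOver s |>.1 (hT.elem i j hij).1, fun h => ?_⟩
      indep := fun i => ?_
      length_lt := fun i => (hF i).length_lt
      witness := hwit
      spreadOut := fun i => (hF i).spreadOut.map s (g i) },
    { universal := fun i => ?_
      proper := fun i => s.ne_of_isUniversalOver (hT.dcM i) ((hlim i).isUniversalOver s)
      resM := fun i => ⟨(hF i).extends_res.1, fun γ δ hδ => ?_⟩
      a := fun _ => rfl
      N := fun _ => rfl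
      resN := fun _ => rfl }, hlim⟩
  · rcases hij.eq_or_lt with rfl | h
    · exact Model.le_refl _
    · rintro _ ⟨x, hx, rfl⟩
      have hxQ := (hF i).M_le_Q hx
      -- Coherence factors `g i` through stage `j`, whose model contains the image of `(F i).Q`.
      rw [← hg2 i j trivial trivial h x hxQ]
      exact ⟨_, (hF j).map_le i h ⟨x, hxQ, rfl⟩, rfl⟩
  · change T.a i ∈ ((F i).M.map (g i)).set at h
    rw [← hga i, Model.apply_mem_map] at h
    exact (hF i).notMem h
  · have h := (hF i).indep.map_of_fixes (g := g i) fun γ x hx =>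
      hgM i x (hNM i ((hT.resN i).le γ hx))
    rwa [hga i] at h
  · change IsUniversalOver ((F i).M.map (g i)).dc _ _
    rw [hdc i]
    exact (hlim i).isUniversalOver s
  · change ((F i).res.seq δ).map (g i) = _
    rw [(hF i).extends_res.2 γ δ hδ]
    exact Model.map_eq_self fun x hx => hgM i x ((hT.resM i).le γ hx)

end Construction

end MetricAEC

/-! ### The theorem: lowering the base of the limit models to completed unions -/

theorem mainTheorem10 {L : FirstOrder.Language.{v, w}} (K : MetricAEC.MAEC.{u} L)
    (𝕄 : MetricAEC.MetricStr.{u} L) (h𝕄 : MetricAEC.IsMonster K 𝕄)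
    (hCTP : MetricAEC.ContinuityOfTypes K 𝕄)
    (μ : Cardinal.{u}) (hLS : K.LS ≤ μ) (hμ : μ < 𝕄.dc)
    (I : Type u) [LinearOrder I] [WellFoundedLT I]
    (hI : Cardinal.mk I = μ) (hcof : Cardinal.aleph0 < Order.cof I)
    (T : MetricAEC.Tower K 𝕄 I) (hT : T.IsMetricSTower μ) :
    ∃ T' : MetricAEC.Tower K 𝕄 I, T'.IsMetricSTower μ ∧ T.IsExtendedBy T' ∧
      ∀ i : I, Order.IsSuccLimit i →
        ∃ C : MetricAEC.Model K 𝕄, C.set = closure (⋃ j : {j // j < i}, (T.M j.1).set) ∧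
          MetricAEC.IsLimitModel μ μ.ord C (T'.M i) := by
  -- Uncountable cofinality is used through its two consequences: μ is uncountable, and `I` has no
  -- last element.
  have hμ0 : ℵ₀ < μ := hcof.trans_le ((Order.cof_le_cardinalMk I).trans hI.le)
  have s : MetricAEC.Setting K 𝕄 μ := ⟨h𝕄, hμ0, hLS, hμ⟩
  have : NoTopOrder I := Order.cof_ne_one_iff.1 (one_lt_aleph0.trans hcof).ne'
  have : NoMaxOrder I := NoTopOrder.to_noMaxOrder I
  obtain ⟨T', hT', hTT', hlim⟩ := MetricAEC.exists_extended_tower s hCTP hI.le hT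
  refine ⟨T', hT', hTT', fun i hi => ?_⟩
  obtain ⟨j, hj⟩ : ∃ j, j < i := not_isMin_iff.1 hi.not_isMin
  have : Nonempty {j // j < i} := ⟨⟨j, hj⟩⟩
  obtain ⟨C, hC⟩ := MetricAEC.Model.exists_chain_union (fun j : {j // j < i} => T.M j.1)
    fun j k hjk => hT.mono _ _ hjk
  have hCi : C ≤ T.M i := by
    rw [MetricAEC.Model.le_def, hC]
    exact closure_minimal (iUnion_subset fun j => hT.mono _ _ j.2.le) (T.M i).isClosed_set
  have hjC : T.M j ≤ C := by
    rw [MetricAEC.Model.le_def, hC]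
    exact (subset_iUnion (fun j : {j // j < i} => (T.M j.1).set) ⟨j, hj⟩).trans subset_closure
  have hCdc : C.dc = μ := MetricAEC.Model.dc_eq_of_le hμ0 hjC (hT.dcM j)
    (MetricAEC.Model.dc_le_of_le hμ0.le hCi (hT.dcM i).le)
  -- `C` may be smaller than `T.M i`, but a limit over `T.M i` is also one over `C`.
  exact ⟨C, hC, (hlim i).of_le s hCdc hCi⟩
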